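/- All graphs are simple. Let $C_n$ ($n\ge 3$) denote the cycle on $n$ vertices. Let $S_{2,2,2}$ be the tree on seven vertices obtained from three paths with two edges each by identifying one end of each path; the identified vertex is its center. For $t\ge 4$, let $A^*_t$ (an apple with a long stem) be the graph on $t+2$ vertices obtained from the cycle $C_t$ by adding a vertex $x$ adjacent to exactly one vertex of the cycle, and then a vertex $y$ adjacent only to $x$. For $t\ge 5$, let $C^*_t$ (an extended cycle) be the graph on $t+2$ vertices obtained from the cycle $C_t$ by choosing four consecutive vertices $v_1,v_2,v_3,v_4$ of the cycle and adding two adjacent vertices $x,y$, where $v_1$ is the only neighbour of $x$ on the cycle and $v_4$ is the only neighbour of $y$ on the cycle (so that $v_1,v_2,v_3,v_4,y,x$ form an induced $C_6$). Let $G$ be a finite connected graph of maximum degree at most $3$ that has no separating clique, i.e. there is no set $K$ of pairwise adjacent vertices of $G$ such that $G-K$ is disconnected. Suppose that $G$ has an induced cycle $C$ of length $p$ that contains the center of some induced copy of $S_{2,2,2}$ in $G$. Then there is an integer $t\ge p/8$ such that $t\ge 5$ and $G$ contains an induced subgraph isomorphic to $C^*_t$, or $t\ge 4$ and $G$ contains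 an induced subgraph isomorphic to $A^*_t$. -/

import Mathlib

/-- A separating clique of `G`: a set of pairwise adjacent vertices whose removal leaves a
disconnected graph, i.e. two remaining vertices that are not joined by a path. -/
def IsSeparatingClique {V : Type*} (G : SimpleGraph V) (K : Set V) : Prop :=
  G.IsClique K ∧ ¬ (G.induce Kᶜ).Preconnected

/-- The tripod `S_{2,2,2}`: the centre `0` and the three paths `0 - 1 - 4`, `0 - 2 - 5`,
`0 - 3 - 6`. -/
def tripod222 : SimpleGraph (Fin 7) :=
  SimpleGraph.fromEdgeSet {s(0, 1), s(0, 2), s(0, 3), s(1, 4), s(2, 5), s(3, 6)}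

/-- The apple with a long stem `A*_t` (meant for `t ≥ 4`): a cycle with vertices
`inl 0, …, inl (t-1)`, the stem `inr 0`, whose only neighbour on the cycle is `inl 0`, and one more
vertex `inr 1`, whose only neighbour is the stem. -/
def longStemApple (t : ℕ) : SimpleGraph (Fin t ⊕ Fin 2) where
  Adj
    | .inl i, .inl j => (SimpleGraph.cycleGraph t).Adj i j
    | .inl i, .inr s => i.val = 0 ∧ s = 0
    | .inr s, .inl i => i.val = 0 ∧ s = 0
    | .inr s, .inr s' => s ≠ s'
  symm := ⟨by
    rintro (i | s) (j | s') h
    · exact SimpleGraph.Adj.symm h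
    · exact h
    · exact h
    · exact Ne.symm h⟩
  loopless := ⟨by
    rintro (i | s) h
    · exact (SimpleGraph.cycleGraph t).irrefl h
    · exact h rfl⟩

/-- The extended cycle `C*_t` (meant for `t ≥ 5`): a cycle with vertices `inl 0, …, inl (t-1)` and
two adjacent extra vertices `inr 0`, `inr 1`, whose only neighbours on the cycle are `inl 0` and
`inl 3` respectively; so the extra vertices form a `C_6` with the four consecutive cycle vertices
`inl 0, inl 1, inl 2, inl 3`. -/
def extendedCycle (t : ℕ) : SimpleGraph (Fin t ⊕ Fin 2) where
  Adj
    | .inl i, .inl j => (SimpleGraph.cycleGraph t).Adj i j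
    | .inl i, .inr s => (i.val = 0 ∧ s = 0) ∨ (i.val = 3 ∧ s = 1)
    | .inr s, .inl i => (i.val = 0 ∧ s = 0) ∨ (i.val = 3 ∧ s = 1)
    | .inr s, .inr s' => s ≠ s'
  symm := ⟨by
    rintro (i | s) (j | s') h
    · exact SimpleGraph.Adj.symm h
    · exact h
    · exact h
    · exact Ne.symm h⟩
  loopless := ⟨by
    rintro (i | s) h
    · exact (SimpleGraph.cycleGraph t).irrefl h
    · exact h rfl⟩

/-! Write the cycle as `c, f 0, …, f n` with `n + 2 = p`, where `c` is the centre of the tripod.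
Since `c` has degree three, the legs are `f 0`, `f n` and a third vertex `x`, with leaves `b₀`, `b₁`
and `y`. The excluded separating cliques matter only as single vertices: they ensure that a vertex
with a neighbour has a second one (`NoPendant`), so a leaf can always be continued.

The engine is averaging. A vertex off the path that already has one other neighbour meets the path
in at most two places `f i`, `f j` with `i ≤ j`. These cut the cycle into a left, a middle and a
right cycle, whose lengths add up to `n` plus a constant. If each of them carries a pendant path
with two edges, one of the three is an apple on about a third of the cycle. Whenever a stem fails
because it touches its cycle again, the extra edges give an extended cycle, or a tripod on a
rerouted cycle to which the argument applies again.

If `x` has no neighbour on the path, this gives `3 * k ≤ n + 7` (`Setup.win_of_free`). The delicate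
case there is `y` adjacent to `f 1` or `f (n - 1)`, handled by `Setup.win_of_lean_one` and by at
most two reroutings. If `x` has path neighbours, the cycle is usually split at them. The expensive
case is the square `c, f 0, f 1, x` (`Setup.win_of_square`): there some pieces of the cycle only
give a tripod with a free third leg, and each such piece costs a factor 3. The worst budget is `3 +
3 + 1 = 7`, which leaves room for the factor 8. -/

/-! ### Induced paths -/

/-- The vertices `f 0, …, f n` form an induced path, in this order. -/
def IndPath {V : Type*} (G : SimpleGraph V) (n : ℕ) (f : ℕ → V) : Prop :=
  ∀ i j, i < j → j ≤ n → (G.Adj (f i) (f j) ↔ j = i + 1)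

/-- Prepend a vertex to a sequence. -/
def seqCons {V : Type*} (x : V) (f : ℕ → V) : ℕ → V
  | 0 => x
  | n + 1 => f n

/-- The conclusion of the main theorem, with a lower bound `k` on the cycle length. -/
def Win {V : Type*} (G : SimpleGraph V) (k : ℕ) : Prop :=
  ∃ t : ℕ, k ≤ t ∧ ((5 ≤ t ∧ Nonempty (extendedCycle t ↪g G)) ∨
    (4 ≤ t ∧ Nonempty (longStemApple t ↪g G)))

theorem cycleGraph_adj_of_lt {t : ℕ} (ht : 3 ≤ t) {i j : Fin t} (hij : i.val < j.val) :
    (SimpleGraph.cycleGraph t).Adj i j ↔ j.val = i.val + 1 ∨ (i.val = 0 ∧ j.val + 1 = t) := by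
  rw [SimpleGraph.cycleGraph_adj']
  have hi := i.isLt
  have hj := j.isLt
  have e1 : (j - i).val = j.val - i.val := Fin.sub_val_of_le hij.le
  have e2 : (i - j).val = t + i.val - j.val := by
    rw [Fin.val_sub, Nat.mod_eq_of_lt (by omega)]; omega
  rw [e1, e2]
  omega

section

variable {V : Type*} {G : SimpleGraph V}

@[simp] theorem seqCons_zero (x : V) (f : ℕ → V) : seqCons x f 0 = x := rfl
@[simp] theorem seqCons_succ (x : V) (f : ℕ → V) (n : ℕ) : seqCons x f (n + 1) = f n := rfl

theorem forall_seqCons {P : V → Prop} {x : V} {f : ℕ → V} {n : ℕ}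
    (hx : P x) (hf : ∀ i ≤ n, P (f i)) : ∀ i ≤ n + 1, P (seqCons x f i) := by
  rintro (_ | i) hi
  · exact hx
  · exact hf i (by omega)

theorem not_adj_seqCons {v x : V} {f : ℕ → V} {n : ℕ} (hx : ¬ G.Adj v x)
    (hf : ∀ i ≤ n, ¬ G.Adj v (f i)) : ∀ i ≤ n + 1, ¬ G.Adj v (seqCons x f i) :=
  forall_seqCons (P := fun w => ¬ G.Adj v w) hx hf

theorem not_adj_symm {v w : V} (h : ¬ G.Adj v w) : ¬ G.Adj w v := fun e => h e.symm

namespace IndPath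

theorem cons {n : ℕ} {f : ℕ → V} (hf : IndPath G n f) {x : V} (h0 : G.Adj x (f 0))
    (h : ∀ i, 0 < i → i ≤ n → ¬ G.Adj x (f i)) : IndPath G (n + 1) (seqCons x f) := by
  rintro (_ | i) (_ | j) hij hj
  · omega
  · rcases Nat.eq_zero_or_pos j with rfl | hj0
    · simpa using h0
    · have := h j hj0 (by omega)
      simp only [seqCons_zero, seqCons_succ, this, false_iff]
      omega
  · omega
  · simp only [seqCons_succ]
    rw [hf i j (by omega) (by omega)]
    omega

theorem shift {n : ℕ} {f : ℕ → V} (hf : IndPath G n f) {a m : ℕ} (h : m + a ≤ n) :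
    IndPath G m (fun i => f (i + a)) := by
  intro i j hij hj
  show G.Adj (f (i + a)) (f (j + a)) ↔ _
  rw [hf (i + a) (j + a) (by omega) (by omega)]
  omega

theorem rev {n : ℕ} {f : ℕ → V} (hf : IndPath G n f) {b m : ℕ} (hb : b ≤ n) (h : m ≤ b) :
    IndPath G m (fun i => f (b - i)) := by
  intro i j hij hj
  show G.Adj (f (b - i)) (f (b - j)) ↔ _
  rw [G.adj_comm, hf (b - j) (b - i) (by omega) (by omega)]
  omega

theorem adj_succ {n : ℕ} {f : ℕ → V} (hf : IndPath G n f) {i : ℕ} (h : i < n) :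
    G.Adj (f i) (f (i + 1)) := (hf i (i + 1) (by omega) (by omega)).2 rfl

theorem adj_iff {n : ℕ} {f : ℕ → V} (hf : IndPath G n f) {i j : ℕ} (hi : i ≤ n) (hj : j ≤ n) :
    G.Adj (f i) (f j) ↔ j = i + 1 ∨ i = j + 1 := by
  rcases lt_trichotomy i j with h | rfl | h
  · rw [hf i j h hj]; omega
  · simp
  · rw [G.adj_comm, hf j i h hi]; omega

theorem not_adj {n : ℕ} {f : ℕ → V} (hf : IndPath G n f) {i j : ℕ} (hi : i ≤ n) (hj : j ≤ n)
    (h1 : j ≠ i + 1) (h2 : i ≠ j + 1) : ¬ G.Adj (f i) (f j) := by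
  rw [hf.adj_iff hi hj]; omega

/-- `IndPath` does not ask for injectivity. Adjacencies alone force it, except that the two ends may
coincide when `n = 2`; `f 0 ≠ f n` excludes this. -/
theorem ne {n : ℕ} {f : ℕ → V} (hf : IndPath G n f) (h0 : f 0 ≠ f n) {i j : ℕ} (hi : i ≤ n)
    (hj : j ≤ n) (hij : i ≠ j) : f i ≠ f j := by
  wlog h : i < j generalizing i j
  · exact (this hj hi hij.symm (by omega)).symm
  intro he
  have h1 : G.Adj (f i) (f (i + 1)) := hf.adj_succ (by omega)
  rw [he, hf.adj_iff hj (by omega)] at h1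
  have h2 : j = i + 2 := by omega
  subst h2
  by_cases hn : i + 2 = n
  · rcases Nat.eq_zero_or_pos i with rfl | hi0
    · subst hn; exact h0 he
    · have h3 : G.Adj (f (i - 1)) (f i) := (hf.adj_iff (by omega) hi).2 (by omega)
      rw [he, hf.adj_iff (by omega) (by omega)] at h3
      omega
  · have h3 : G.Adj (f (i + 2)) (f (i + 3)) := (hf.adj_iff (by omega) (by omega)).2 (by omega)
    rw [← he, hf.adj_iff (by omega) (by omega)] at h3
    omega

end IndPath

/-! ### Recognising apples and extended cycles -/

theorem ring_spec {n : ℕ} {f : ℕ → V} {z : V} (hf : IndPath G n f) (h2 : 2 ≤ n)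
    (h0n : f 0 ≠ f n) (z0 : G.Adj z (f 0)) (zn : G.Adj z (f n))
    (zm : ∀ i, 0 < i → i < n → ¬ G.Adj z (f i)) (zf : ∀ i ≤ n, z ≠ f i) (i j : Fin (n + 2)) :
    (seqCons z f i.val = seqCons z f j.val → i = j) ∧
      (G.Adj (seqCons z f i.val) (seqCons z f j.val) ↔
        (SimpleGraph.cycleGraph (n + 2)).Adj i j) := by
  have zadj : ∀ i ≤ n, (G.Adj z (f i) ↔ i = 0 ∨ i = n) := by
    intro i hi
    constructor
    · intro h; by_contra hc; exact zm i (by omega) (by omega) h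
    · rintro (rfl | rfl) <;> assumption
  have hcyc : ∀ i j : Fin (n + 2), i.val < j.val →
      seqCons z f i.val ≠ seqCons z f j.val ∧
      (G.Adj (seqCons z f i.val) (seqCons z f j.val) ↔
        (SimpleGraph.cycleGraph (n + 2)).Adj i j) := by
    intro i j hij
    rw [cycleGraph_adj_of_lt (by omega) hij]
    obtain ⟨i, hi⟩ := i
    obtain ⟨j, hj⟩ := j
    obtain _ | i := i <;> obtain _ | j := j <;> simp only [seqCons_zero, seqCons_succ] at hij ⊢
    · omega
    · refine ⟨zf j (by omega), ?_⟩
      rw [zadj j (by omega)]; simp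
    · omega
    · refine ⟨hf.ne h0n (by omega) (by omega) (by omega), ?_⟩
      rw [hf.adj_iff (by omega) (by omega)]; omega
  rcases lt_trichotomy i.val j.val with hl | hl | hl
  · exact ⟨fun h => absurd h (hcyc i j hl).1, (hcyc i j hl).2⟩
  · rw [Fin.ext hl]; simp
  · refine ⟨fun h => absurd h.symm (hcyc j i hl).1, ?_⟩
    rw [G.adj_comm, SimpleGraph.adj_comm _ i]
    exact (hcyc j i hl).2

/-- When `n ≥ 2`, every path vertex has a path neighbour other than `f 0`, so a vertex without such
neighbours is off the path. -/
theorem IndPath.ne_of_end {n : ℕ} {f : ℕ → V} (hf : IndPath G n f) (h1 : 2 ≤ n) {a : V}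
    (ha : ∀ i, 0 < i → i ≤ n → ¬ G.Adj a (f i)) : ∀ i ≤ n, a ≠ f i := by
  intro i hi h
  by_cases hin : i < n
  · exact ha (i + 1) (by omega) (by omega) (h ▸ hf.adj_succ hin)
  · exact ha (i - 1) (by omega) (by omega) (h ▸ (hf.adj_iff hi (by omega)).2 (by omega))

theorem IndPath.ne_of_end' {n : ℕ} {f : ℕ → V} (hf : IndPath G n f) (h1 : 2 ≤ n) {a : V}
    (ha : ∀ i, i < n → ¬ G.Adj a (f i)) : ∀ i ≤ n, a ≠ f i := by
  intro i hi h
  by_cases hin : 0 < i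
  · exact ha (i - 1) (by omega) (h ▸ (hf.adj_iff hi (by omega)).2 (by omega))
  · exact ha (i + 1) (by omega) (h ▸ hf.adj_succ (by omega))

/-- The cycle is `z, f 0, …, f n`, of length `n + 2`, and the stem is `s, e`. All distinctness
beyond `f 0 ≠ f n` follows from the adjacencies. -/
theorem win_apple {k n : ℕ} {f : ℕ → V} {z s e : V} (hf : IndPath G n f) (h2 : 2 ≤ n)
    (h0n : f 0 ≠ f n) (z0 : G.Adj z (f 0)) (zn : G.Adj z (f n))
    (zm : ∀ i, 0 < i → i < n → ¬ G.Adj z (f i)) (sz : G.Adj s z)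
    (sf : ∀ i ≤ n, ¬ G.Adj s (f i)) (es : G.Adj e s) (ez : ¬ G.Adj e z)
    (ef : ∀ i ≤ n, ¬ G.Adj e (f i)) (hk : k ≤ n + 2) : Win G k := by
  have zf : ∀ i ≤ n, z ≠ f i := fun i hi h => sf i hi (h ▸ sz)
  have sfn : ∀ i ≤ n, s ≠ f i := hf.ne_of_end' (by omega) fun i hi => sf i (le_of_lt hi)
  have efn : ∀ i ≤ n, e ≠ f i := hf.ne_of_end (by omega) fun i _ hi => ef i hi
  have ezn : e ≠ z := by rintro rfl; exact ef 0 (by omega) z0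
  let φ : Fin (n + 2) ⊕ Fin 2 → V
    | .inl i => seqCons z f i.val
    | .inr j => if j = 0 then s else e
  have hcyc := ring_spec hf h2 h0n z0 zn zm zf
  have hs : ∀ i : Fin (n + 2), s ≠ seqCons z f i.val ∧
      (G.Adj s (seqCons z f i.val) ↔ i.val = 0) := by
    rintro ⟨_ | i, hi⟩
    · exact ⟨sz.ne, by simpa using sz⟩
    · exact ⟨sfn i (by omega), by simpa using sf i (by omega)⟩
  have he : ∀ i : Fin (n + 2), e ≠ seqCons z f i.val ∧
      ¬ G.Adj e (seqCons z f i.val) := by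
    rintro ⟨_ | i, hi⟩
    · exact ⟨ezn, ez⟩
    · exact ⟨efn i (by omega), ef i (by omega)⟩
  refine ⟨n + 2, hk, Or.inr ⟨by omega, ⟨⟨⟨φ, ?_⟩, ?_⟩⟩⟩⟩
  · rintro (i | i) (j | j) h
    · rw [(hcyc i j).1 h]
    · fin_cases j
      · exact absurd h.symm (hs i).1
      · exact absurd h.symm (he i).1
    · fin_cases i
      · exact absurd h (hs j).1
      · exact absurd h (he j).1
    · fin_cases i <;> fin_cases j
      · rfl
      · exact absurd h.symm es.ne
      · exact absurd h es.ne
      · rfl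
  · rintro (i | i) (j | j)
    · exact (hcyc i j).2
    · fin_cases j
      · show G.Adj (seqCons z f i.val) s ↔ i.val = 0 ∧ (0 : Fin 2) = 0
        rw [G.adj_comm, (hs i).2]; simp
      · show G.Adj (seqCons z f i.val) e ↔ i.val = 0 ∧ (1 : Fin 2) = 0
        rw [G.adj_comm]; simpa using (he i).2
    · fin_cases i
      · show G.Adj s (seqCons z f j.val) ↔ j.val = 0 ∧ (0 : Fin 2) = 0
        rw [(hs j).2]; simp
      · show G.Adj e (seqCons z f j.val) ↔ j.val = 0 ∧ (1 : Fin 2) = 0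
        simpa using (he j).2
    · fin_cases i <;> fin_cases j
      · show G.Adj s s ↔ (0 : Fin 2) ≠ 0
        simp
      · show G.Adj s e ↔ (0 : Fin 2) ≠ 1
        simpa using es.symm
      · show G.Adj e s ↔ (1 : Fin 2) ≠ 0
        simpa using es
      · show G.Adj e e ↔ (1 : Fin 2) ≠ 1
        simp

/-- Two ears `p q` and `x y` attached to the ends of an induced path form an extended cycle. -/
theorem win_ext {k n : ℕ} {f : ℕ → V} {p q x y : V} (hf : IndPath G n f) (h2 : 2 ≤ n)
    (p0 : G.Adj p (f 0)) (pf : ∀ i, 0 < i → i ≤ n → ¬ G.Adj p (f i))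
    (qn : G.Adj q (f n)) (qf : ∀ i, i < n → ¬ G.Adj q (f i))
    (x0 : G.Adj x (f 0)) (xf : ∀ i, 0 < i → i ≤ n → ¬ G.Adj x (f i))
    (yn : G.Adj y (f n)) (yf : ∀ i, i < n → ¬ G.Adj y (f i))
    (pq : G.Adj p q) (xy : G.Adj x y) (xp : ¬ G.Adj x p) (xq : ¬ G.Adj x q)
    (yp : ¬ G.Adj y p) (yq : ¬ G.Adj y q) (hk : k ≤ n + 3) : Win G k := by
  have h0n : f 0 ≠ f n := by
    intro h; rw [h] at p0; exact pf n (by omega) le_rfl p0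
  have pne := hf.ne_of_end (by omega) pf
  have xne := hf.ne_of_end (by omega) xf
  have qne := hf.ne_of_end' (by omega) qf
  have yne := hf.ne_of_end' (by omega) yf
  have hg : IndPath G (n - 1 + 2) (seqCons p (seqCons q (fun i => f (n - i)))) := by
    refine ((hf.rev le_rfl (by omega)).cons (by simpa using qn) ?_).cons pq ?_
    · intro i h0 hi; exact qf _ (by omega)
    · rintro (_ | i) h0 hi
      · omega
      · exact pf _ (by omega) (by omega)
  obtain ⟨m, rfl⟩ : ∃ m, n = m + 1 := ⟨n - 1, by omega⟩
  have hcyc := ring_spec hg (by omega) (z := f 0) (pne _ (by omega)) p0.symm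
    (show G.Adj (f 0) (f (m + 1 - m)) from
      (hf.adj_iff (by omega) (by omega)).2 (by omega)) (by
      rintro (_ | _ | i) h0 hi
      · omega
      · exact fun h => qf 0 (by omega) h.symm
      · exact hf.not_adj (by omega) (by omega) (by omega) (by omega)) (by
      rintro (_ | _ | i) hi
      · exact (pne 0 (by omega)).symm
      · exact (qne 0 (by omega)).symm
      · exact hf.ne h0n (by omega) (by omega) (by omega))
  let φ : Fin (m + 1 - 1 + 2 + 2) ⊕ Fin 2 → V
    | .inl i => seqCons (f 0) (seqCons p (seqCons q (fun i => f (m + 1 - i)))) i.val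
    | .inr j => if j = 0 then x else y
  have hx : ∀ i : Fin (m + 1 - 1 + 2 + 2),
      x ≠ seqCons (f 0) (seqCons p (seqCons q (fun i => f (m + 1 - i)))) i.val ∧
      (G.Adj x (seqCons (f 0) (seqCons p (seqCons q (fun i => f (m + 1 - i)))) i.val) ↔
        i.val = 0) := by
    rintro ⟨_ | _ | _ | i, hi⟩
    · exact ⟨x0.ne, by simpa using x0⟩
    · refine ⟨?_, by simpa using xp⟩
      rintro rfl; exact yp xy.symm
    · refine ⟨?_, by simpa using xq⟩
      rintro rfl; exact yq xy.symm
    · exact ⟨xne _ (by omega), by simpa using xf _ (by omega) (by omega)⟩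
  have hy : ∀ i : Fin (m + 1 - 1 + 2 + 2),
      y ≠ seqCons (f 0) (seqCons p (seqCons q (fun i => f (m + 1 - i)))) i.val ∧
      (G.Adj y (seqCons (f 0) (seqCons p (seqCons q (fun i => f (m + 1 - i)))) i.val) ↔
        i.val = 3) := by
    rintro ⟨_ | _ | _ | _ | i, hi⟩
    · exact ⟨yne 0 (by omega), by simpa using yf 0 (by omega)⟩
    · refine ⟨?_, by simpa using yp⟩
      rintro rfl; exact xp xy
    · refine ⟨?_, by simpa using yq⟩
      rintro rfl; exact xq xy
    · exact ⟨yn.ne, by simpa using yn⟩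
    · exact ⟨yne _ (by omega), by simpa using yf _ (by omega)⟩
  refine ⟨m + 1 - 1 + 2 + 2, by omega, Or.inl ⟨by omega, ⟨⟨⟨φ, ?_⟩, ?_⟩⟩⟩⟩
  · rintro (i | i) (j | j) h
    · rw [(hcyc i j).1 h]
    · fin_cases j
      · exact absurd h.symm (hx i).1
      · exact absurd h.symm (hy i).1
    · fin_cases i
      · exact absurd h (hx j).1
      · exact absurd h (hy j).1
    · fin_cases i <;> fin_cases j
      · rfl
      · exact absurd h xy.ne
      · exact absurd h.symm xy.ne
      · rfl
  · rintro (i | i) (j | j)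
    · exact (hcyc i j).2
    · fin_cases j
      · refine (G.adj_comm _ _).trans ((hx i).2.trans ?_)
        show _ ↔ (i.val = 0 ∧ (0 : Fin 2) = 0) ∨ (i.val = 3 ∧ (0 : Fin 2) = 1)
        simp
      · refine (G.adj_comm _ _).trans ((hy i).2.trans ?_)
        show _ ↔ (i.val = 0 ∧ (1 : Fin 2) = 0) ∨ (i.val = 3 ∧ (1 : Fin 2) = 1)
        simp
    · fin_cases i
      · refine (hx j).2.trans ?_
        show _ ↔ (j.val = 0 ∧ (0 : Fin 2) = 0) ∨ (j.val = 3 ∧ (0 : Fin 2) = 1)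
        simp
      · refine (hy j).2.trans ?_
        show _ ↔ (j.val = 0 ∧ (1 : Fin 2) = 0) ∨ (j.val = 3 ∧ (1 : Fin 2) = 1)
        simp
    · fin_cases i <;> fin_cases j
      · show G.Adj x x ↔ (0 : Fin 2) ≠ 0
        simp
      · show G.Adj x y ↔ (0 : Fin 2) ≠ 1
        simpa using xy
      · show G.Adj y x ↔ (1 : Fin 2) ≠ 0
        simpa using xy.symm
      · show G.Adj y y ↔ (1 : Fin 2) ≠ 1
        simp

/-! ### Tripods and cycles through their centre -/

/-- An induced tripod with centre `c`, legs `a₀, a₁, a₂` and leaves `b₀, b₁, b₂`. -/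
structure Tri (G : SimpleGraph V) (c a₀ b₀ a₁ b₁ a₂ b₂ : V) : Prop where
  ca0 : G.Adj c a₀
  ca1 : G.Adj c a₁
  ca2 : G.Adj c a₂
  ab0 : G.Adj a₀ b₀
  ab1 : G.Adj a₁ b₁
  ab2 : G.Adj a₂ b₂
  aa01 : ¬ G.Adj a₀ a₁
  aa02 : ¬ G.Adj a₀ a₂
  aa12 : ¬ G.Adj a₁ a₂
  ab01 : ¬ G.Adj a₀ b₁
  ab02 : ¬ G.Adj a₀ b₂
  ab10 : ¬ G.Adj a₁ b₀
  ab12 : ¬ G.Adj a₁ b₂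
  ab20 : ¬ G.Adj a₂ b₀
  ab21 : ¬ G.Adj a₂ b₁
  bb01 : ¬ G.Adj b₀ b₁
  bb02 : ¬ G.Adj b₀ b₂
  bb12 : ¬ G.Adj b₁ b₂
  cb0 : ¬ G.Adj c b₀
  cb1 : ¬ G.Adj c b₁
  cb2 : ¬ G.Adj c b₂

namespace Tri

variable {c a₀ b₀ a₁ b₁ a₂ b₂ : V}

theorem swap01 (h : Tri G c a₀ b₀ a₁ b₁ a₂ b₂) : Tri G c a₁ b₁ a₀ b₀ a₂ b₂ where
  ca0 := h.ca1
  ca1 := h.ca0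
  ca2 := h.ca2
  ab0 := h.ab1
  ab1 := h.ab0
  ab2 := h.ab2
  aa01 := fun e => h.aa01 e.symm
  aa02 := h.aa12
  aa12 := h.aa02
  ab01 := h.ab10
  ab02 := h.ab12
  ab10 := h.ab01
  ab12 := h.ab02
  ab20 := h.ab21
  ab21 := h.ab20
  bb01 := fun e => h.bb01 e.symm
  bb02 := h.bb12
  bb12 := h.bb02
  cb0 := h.cb1
  cb1 := h.cb0
  cb2 := h.cb2

theorem swap02 (h : Tri G c a₀ b₀ a₁ b₁ a₂ b₂) : Tri G c a₂ b₂ a₁ b₁ a₀ b₀ where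
  ca0 := h.ca2
  ca1 := h.ca1
  ca2 := h.ca0
  ab0 := h.ab2
  ab1 := h.ab1
  ab2 := h.ab0
  aa01 := fun e => h.aa12 e.symm
  aa02 := fun e => h.aa02 e.symm
  aa12 := fun e => h.aa01 e.symm
  ab01 := h.ab21
  ab02 := h.ab20
  ab10 := h.ab12
  ab12 := h.ab10
  ab20 := h.ab02
  ab21 := h.ab01
  bb01 := fun e => h.bb12 e.symm
  bb02 := fun e => h.bb02 e.symm
  bb12 := fun e => h.bb01 e.symm
  cb0 := h.cb2
  cb1 := h.cb1
  cb2 := h.cb0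

theorem ne01 (h : Tri G c a₀ b₀ a₁ b₁ a₂ b₂) : a₀ ≠ a₁ := by
  rintro rfl; exact h.ab01 h.ab1

theorem ne02 (h : Tri G c a₀ b₀ a₁ b₁ a₂ b₂) : a₀ ≠ a₂ := by
  rintro rfl; exact h.ab02 h.ab2

theorem ne12 (h : Tri G c a₀ b₀ a₁ b₁ a₂ b₂) : a₁ ≠ a₂ := by
  rintro rfl; exact h.ab12 h.ab2

end Tri

/-- The vertex `c` closes the induced path `f 0, …, f n` to an induced cycle. -/
structure RingAt (G : SimpleGraph V) (c : V) (n : ℕ) (f : ℕ → V) : Prop where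
  path : IndPath G n f
  c0 : G.Adj c (f 0)
  cn : G.Adj c (f n)
  mid : ∀ i, 0 < i → i < n → ¬ G.Adj c (f i)

/-- Every vertex has at most three neighbours. -/
def Subcubic (G : SimpleGraph V) : Prop :=
  ∀ ⦃v a b c d : V⦄, G.Adj v a → G.Adj v b → G.Adj v c → a ≠ b → a ≠ c → b ≠ c → G.Adj v d →
    d = a ∨ d = b ∨ d = c

/-- Every vertex with a neighbour has a second one. -/
def NoPendant (G : SimpleGraph V) : Prop :=
  ∀ ⦃a b : V⦄, G.Adj a b → ∃ u, u ≠ a ∧ G.Adj b u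

/-- An induced cycle through `c` together with an induced tripod with centre `c`, two legs of
which are the neighbours of `c` on the cycle. -/
structure Setup (G : SimpleGraph V) (c : V) (n : ℕ) (f : ℕ → V) (b₀ b₁ x y : V) : Prop where
  ring : RingAt G c n f
  tri : Tri G c (f 0) b₀ (f n) b₁ x y

/-- The least and the greatest index of a neighbour on a sequence. -/
theorem exists_first_last {P : ℕ → Prop} {n : ℕ} (h : ∃ k ≤ n, P k) :
    ∃ i j, i ≤ j ∧ j ≤ n ∧ P i ∧ P j ∧ (∀ k < i, ¬ P k) ∧ ∀ k, j < k → k ≤ n → ¬ P k := by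
  classical
  obtain ⟨k, hk, hP⟩ := h
  have h1 : ∃ i, P i := ⟨k, hP⟩
  have h2 : ∃ m, m ≤ n ∧ P (n - m) := ⟨n - k, by omega, by rwa [Nat.sub_sub_self hk]⟩
  refine ⟨Nat.find h1, n - Nat.find h2, ?_, by omega, Nat.find_spec h1, (Nat.find_spec h2).2,
    fun k hk => Nat.find_min h1 hk, ?_⟩
  · exact Nat.find_min' h1 (Nat.find_spec h2).2
  · intro m hm hmn hPm
    exact Nat.find_min h2 (m := n - m) (by omega) ⟨by omega, by rwa [Nat.sub_sub_self hmn]⟩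

namespace Setup

variable {c : V} {n : ℕ} {f : ℕ → V} {b₀ b₁ x y : V}

theorem rev (h : Setup G c n f b₀ b₁ x y) : Setup G c n (fun i => f (n - i)) b₁ b₀ x y where
  ring :=
    { path := h.ring.path.rev le_rfl le_rfl
      c0 := by simpa using h.ring.cn
      cn := by simpa using h.ring.c0
      mid := fun i h0 hn => h.ring.mid _ (by omega) (by omega) }
  tri := by simpa using h.tri.swap01

theorem two_le (h : Setup G c n f b₀ b₁ x y) : 2 ≤ n := by
  by_contra hn
  have h1 := h.tri.ne01
  have h2 := h.tri.aa01
  rcases n with _ | _ | n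
  · exact h1 rfl
  · exact h2 (h.ring.path.adj_succ (by omega))
  · omega

theorem ne (h : Setup G c n f b₀ b₁ x y) {i j : ℕ} (hi : i ≤ n) (hj : j ≤ n) (hij : i ≠ j) :
    f i ≠ f j := h.ring.path.ne h.tri.ne01 hi hj hij

/-- A neighbour outside the cycle of an inner path vertex is its only neighbour off the path. -/
theorem full (h : Setup G c n f b₀ b₁ x y) (hG : Subcubic G) {i : ℕ} (h0 : 0 < i) (hn : i < n)
    {u w : V} (hu : G.Adj (f i) u) (hu' : ∀ j ≤ n, u ≠ f j) (hw : G.Adj (f i) w)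
    (hw' : ∀ j ≤ n, w ≠ f j) : w = u := by
  have h1 : G.Adj (f i) (f (i - 1)) := (h.ring.path.adj_iff (by omega) (by omega)).2 (by omega)
  have h2 : G.Adj (f i) (f (i + 1)) := h.ring.path.adj_succ hn
  rcases hG h1 h2 hu (h.ne (by omega) (by omega) (by omega)) (hu' _ (by omega)).symm
    (hu' _ (by omega)).symm hw with h3 | h3 | h3
  · exact absurd h3 (hw' _ (by omega))
  · exact absurd h3 (hw' _ (by omega))
  · exact h3

/-- A vertex with a neighbour `a` outside a final part of the path has at most two neighbours
on that part. -/
theorem attach (h : Setup G c n f b₀ b₁ x y) (hG : Subcubic G) {w a : V} (hwa : G.Adj w a)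
    (l : ℕ) (ha : ∀ i, l ≤ i → i ≤ n → a ≠ f i) (hw : ∃ k ≤ n, l ≤ k ∧ G.Adj w (f k)) :
    ∃ i j, l ≤ i ∧ i ≤ j ∧ j ≤ n ∧ G.Adj w (f i) ∧ G.Adj w (f j) ∧
      (∀ m, l ≤ m → m ≤ n → G.Adj w (f m) → m = i ∨ m = j) := by
  obtain ⟨i, j, hij, hj, ⟨hl, hi'⟩, ⟨-, hj'⟩, h1, h2⟩ := exists_first_last hw
  refine ⟨i, j, hl, hij, hj, hi', hj', fun m hml hm hwm => ?_⟩
  have h3 : i ≤ m := not_lt.1 fun hlt => h1 m hlt ⟨hml, hwm⟩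
  have h4 : m ≤ j := not_lt.1 fun hlt => h2 m hlt hm ⟨hml, hwm⟩
  by_contra hc
  rcases hG hi' hj' hwa (h.ne (by omega) hj (by omega)) (ha _ hl (by omega)).symm
    (ha _ (by omega) hj).symm hwm with h5 | h5 | h5
  · exact h.ne hm (by omega) (by omega) h5
  · exact h.ne hm hj (by omega) h5
  · exact ha _ hml hm h5.symm

theorem x_ne (h : Setup G c n f b₀ b₁ x y) : ∀ i ≤ n, x ≠ f i := by
  intro i hi hx
  rcases Nat.eq_zero_or_pos i with rfl | h0
  · exact h.tri.ne02 hx.symm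
  · rcases Nat.lt_or_ge i n with h1 | h1
    · exact h.ring.mid i h0 h1 (hx ▸ h.tri.ca2)
    · obtain rfl : i = n := by omega
      exact h.tri.ne12 hx.symm

theorem y_ne (h : Setup G c n f b₀ b₁ x y) (hx : ∀ i ≤ n, ¬ G.Adj x (f i)) :
    ∀ i ≤ n, y ≠ f i := fun i hi hy => hx i hi (hy ▸ h.tri.ab2)

theorem c_ne (h : Setup G c n f b₀ b₁ x y) (hx : ∀ i ≤ n, ¬ G.Adj x (f i)) :
    ∀ i ≤ n, c ≠ f i := fun i hi hc => hx i hi (hc ▸ h.tri.ca2.symm)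

theorem c_full (h : Setup G c n f b₀ b₁ x y) (hG : Subcubic G) {u : V} (hu : G.Adj c u) :
    u = f 0 ∨ u = f n ∨ u = x :=
  hG h.ring.c0 h.ring.cn h.tri.ca2 h.tri.ne01 h.tri.ne02 h.tri.ne12 hu

/-! ### Third leg free, its leaf away from the ends -/

/-- The cycle through the part of the path before the attachments of `y`. -/
theorem win_left (h : Setup G c n f b₀ b₁ x y) (hx : ∀ i ≤ n, ¬ G.Adj x (f i)) {i j k : ℕ}
    (hi : 1 ≤ i) (hij : i ≤ j) (hj : j + 2 ≤ n) (hyi : G.Adj y (f i))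
    (hy : ∀ m ≤ n, G.Adj y (f m) → m = i ∨ m = j) (hk : k ≤ i + 4) : Win G k := by
  have hp := h.ring.path
  -- The cycle is `c, f 0, …, f i, y, x` with stem `f n, f (n - 1)`. The stem touches the cycle
  -- again only if `i = n - 2`; then `f n, f (n - 1)` is a second ear from `c` to `f i`, parallel to
  -- `x, y`.
  by_cases hc : i = j ∧ j + 2 = n
  · obtain ⟨rfl, rfl⟩ := hc
    have hP : IndPath G (i + 1) (seqCons c f) :=
      IndPath.cons (fun a b hab hb => hp a b hab (by omega)) h.ring.c0
        fun m h0 hm => h.ring.mid m h0 (by omega)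
    refine win_ext (p := x) (q := y) (x := f (i + 2)) (y := f (i + 1)) hP (by omega)
      h.tri.ca2.symm ?_ hyi ?_ h.ring.cn.symm ?_ (hp.adj_succ (by omega)).symm ?_ h.tri.ab2
      (hp.adj_succ (by omega)).symm h.tri.aa12 h.tri.ab12 (fun e => hx _ (by omega) e.symm)
      (fun e => by have := hy _ (by omega) e.symm; omega) (by omega)
    · rintro (_ | m) h0 hm
      · omega
      · exact hx m (by omega)
    · rintro (_ | m) hm
      · exact fun e => h.tri.cb2 e.symm
      · intro e
        have := hy m (by omega) e
        omega
    · rintro (_ | m) h0 hm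
      · omega
      · exact hp.not_adj (by omega) (by omega) (by omega) (by omega)
    · rintro (_ | m) hm
      · exact fun e => h.ring.mid _ (by omega) (by omega) e.symm
      · exact hp.not_adj (by omega) (by omega) (by omega) (by omega)
  · have hP : IndPath G (i + 2) (seqCons x (seqCons y (fun m => f (i - m)))) := by
      refine ((hp.rev (b := i) (m := i) (by omega) le_rfl).cons hyi ?_).cons h.tri.ab2 ?_
      · intro m h0 hm e
        have := hy _ (by omega) e
        omega
      · rintro (_ | m) h0 hm
        · omega
        · exact hx _ (by omega)
    refine win_apple (z := c) (s := f n) (e := f (n - 1)) hP (by omega) ?_ h.tri.ca2 ?_ ?_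
      h.ring.cn.symm ?_ ((hp.adj_iff (by omega) le_rfl).2 (by omega)) ?_ ?_ (by omega)
    · simpa using h.x_ne 0 (by omega)
    · simpa using h.ring.c0
    · rintro (_ | _ | m) h0 hm
      · omega
      · exact h.tri.cb2
      · exact h.ring.mid _ (by omega) (by omega)
    · exact not_adj_seqCons h.tri.aa12 <| not_adj_seqCons h.tri.ab12 fun m hm =>
        hp.not_adj (by omega) (by omega) (by omega) (by omega)
    · exact fun e => h.ring.mid _ (by omega) (by omega) e.symm
    · refine not_adj_seqCons (fun e => hx _ (by omega) e.symm) <| not_adj_seqCons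
        (fun e => ?_) fun m hm => hp.not_adj (by omega) (by omega) (by omega) (by omega)
      have := hy _ (by omega) e.symm
      omega

theorem win_right (h : Setup G c n f b₀ b₁ x y) (hx : ∀ i ≤ n, ¬ G.Adj x (f i)) {i j k : ℕ}
    (hi : 2 ≤ i) (hij : i ≤ j) (hj : j + 1 ≤ n) (hyj : G.Adj y (f j))
    (hy : ∀ m ≤ n, G.Adj y (f m) → m = i ∨ m = j) (hk : k + j ≤ n + 4) : Win G k := by
  refine h.rev.win_left (i := n - j) (j := n - i) (fun m _ => hx _ (by omega)) (by omega)
    (by omega) (by omega) ?_ ?_ (by omega)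
  · rwa [Nat.sub_sub_self (by omega)]
  · intro m hm e
    have := hy _ (by omega) e
    omega

/-- The cycle through a vertex `w` attached to the path at `f i` and `f j`, with a stem. -/
theorem win_mid (h : Setup G c n f b₀ b₁ x y) {i j k : ℕ} {w s e : V} (hij : i + 2 ≤ j)
    (hj : j ≤ n) (hi : G.Adj w (f i)) (hj' : G.Adj w (f j))
    (hw : ∀ m, i ≤ m → m ≤ n → G.Adj w (f m) → m = i ∨ m = j) (sw : G.Adj s w) (es : G.Adj e s)
    (ew : ¬ G.Adj e w) (hs : ∀ m, i ≤ m → m ≤ j → ¬ G.Adj s (f m))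
    (he : ∀ m, i ≤ m → m ≤ j → ¬ G.Adj e (f m)) (hk : k + i ≤ j + 2) : Win G k := by
  refine win_apple (z := w) (h.ring.path.shift (a := i) (m := j - i) (by omega)) (by omega) ?_
    (by simpa using hi) ?_ ?_ sw (fun m hm => hs _ (by omega) (by omega)) es ew
    (fun m hm => he _ (by omega) (by omega)) (by omega)
  · exact h.ne (by omega) (by omega) (by omega)
  · rwa [Nat.sub_add_cancel (by omega)]
  · intro m h0 hm e
    have := hw _ (by omega) (by omega) e
    omega

/-- The cycle `y, f i, …, f j` with stem `x, c`. -/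
theorem win_mid_y (h : Setup G c n f b₀ b₁ x y) (hx : ∀ i ≤ n, ¬ G.Adj x (f i)) {i j k : ℕ}
    (hij : i + 2 ≤ j) (hi : 0 < i) (hj : j < n) (hyi : G.Adj y (f i)) (hyj : G.Adj y (f j))
    (hy : ∀ m ≤ n, G.Adj y (f m) → m = i ∨ m = j) (hk : k + i ≤ j + 2) : Win G k :=
  h.win_mid hij hj.le hyi hyj (fun m _ => hy m) h.tri.ab2 h.tri.ca2 h.tri.cb2 (fun m _ hm => hx m (by omega))
    (fun m _ hm => h.ring.mid m (by omega) (by omega)) hk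

theorem win_none (h : Setup G c n f b₀ b₁ x y) (hx : ∀ i ≤ n, ¬ G.Adj x (f i)) {k : ℕ}
    (hy : ∀ i ≤ n, ¬ G.Adj y (f i)) (hk : k ≤ n + 2) : Win G k :=
  win_apple h.ring.path h.two_le h.tri.ne01 h.ring.c0 h.ring.cn h.ring.mid h.tri.ca2.symm hx
    h.tri.ab2.symm (fun e => h.tri.cb2 e.symm) hy hk

/-- The attachments of the leaf `y` on the path, if there are any. -/
theorem attach_y (h : Setup G c n f b₀ b₁ x y) (hG : Subcubic G)
    (hw : ∃ k ≤ n, G.Adj y (f k)) :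
    ∃ i j, 1 ≤ i ∧ i ≤ j ∧ j + 1 ≤ n ∧ G.Adj y (f i) ∧ G.Adj y (f j) ∧
      (∀ m ≤ n, G.Adj y (f m) → m = i ∨ m = j) := by
  obtain ⟨i, j, -, hij, hj, h1, h2, h3⟩ := h.attach hG h.tri.ab2.symm 0
    (fun i _ => h.x_ne i) (by simpa using hw)
  refine ⟨i, j, ?_, hij, ?_, h1, h2, fun m => h3 m (Nat.zero_le _)⟩
  · rcases Nat.eq_zero_or_pos i with rfl | h0
    · exact absurd h1.symm h.tri.ab02
    · exact h0
  · rcases Nat.lt_or_ge j n with h0 | h0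
    · exact h0
    · obtain rfl : j = n := by omega
      exact absurd h2.symm h.tri.ab12

/-- The left, right and middle cycles have lengths `i + 4`, `n - j + 4` and `j - i + 2`, with sum `n
+ 10`. Since `y` misses `f 1` and `f (n - 1)`, both `f 0, f 1` and `f n, f (n - 1)` can serve as
stems. -/
theorem win_of_not_lean (h : Setup G c n f b₀ b₁ x y) (hG : Subcubic G)
    (hx : ∀ i ≤ n, ¬ G.Adj x (f i)) {k : ℕ} (hl : ¬ G.Adj y (f 1)) (hr : ¬ G.Adj y (f (n - 1)))
    (hk : 3 * k ≤ n + 10) : Win G k := by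
  have h2 := h.two_le
  by_cases hw : ∃ k ≤ n, G.Adj y (f k)
  · obtain ⟨i, j, h0, hij, hj, hyi, hyj, hy⟩ := h.attach_y hG hw
    have hi1 : i ≠ 1 := by rintro rfl; exact hl hyi
    have hj1 : j ≠ n - 1 := by rintro rfl; exact hr hyj
    by_cases k1 : k ≤ i + 4
    · exact h.win_left hx h0 hij (by omega) hyi hy k1
    by_cases k2 : k + j ≤ n + 4
    · exact h.win_right hx (by omega) hij (by omega) hyj hy k2
    exact h.win_mid_y hx (by omega) h0 (by omega) hyi hyj hy (by omega)
  · push Not at hw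
    exact h.win_none hx hw (by omega)

/-! ### The leaf of the free leg leans on `f 1` -/

/-- The leaf `y` is adjacent to `f 1` only, and `b₀` has a further neighbour on the path. -/
theorem win_of_lean_of_adj (h : Setup G c n f b₀ b₁ x y) (hG : Subcubic G)
    (hx : ∀ i ≤ n, ¬ G.Adj x (f i)) {k : ℕ} (hy1 : G.Adj y (f 1))
    (hy : ∀ m ≤ n, G.Adj y (f m) → m = 1) (hb : ∀ m ≤ n, b₀ ≠ f m) (hb1 : ¬ G.Adj b₀ (f 1))
    (hw : ∃ m ≤ n, 1 ≤ m ∧ G.Adj b₀ (f m)) (hk : 3 * k ≤ n + 8) : Win G k := by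
  have hp := h.ring.path
  have h2 := h.two_le
  obtain ⟨i, j, hi, hij, hj, hbi, hbj, hbm⟩ := h.attach hG h.tri.ab0.symm 1
    (fun i h1 hi => h.ne (by omega) hi (by omega)) hw
  have hi1 : i ≠ 1 := by rintro rfl; exact hb1 hbi
  have hjn : j ≠ n := by rintro rfl; exact h.tri.ab10 hbj.symm
  have hy2 : ∀ m, 2 ≤ m → m ≤ n → ¬ G.Adj y (f m) := fun m h1 hm e => by
    have := hy m hm e; omega
  -- The three cycles are closed through `f 0, b₀, c`, through `f 0, b₀, f 1` and through `b₀`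
  -- alone. Their lengths `n - j + 4`, `i + 2` and `j - i + 2` add up to `n + 8`.
  by_cases k1 : k + j ≤ n + 4
  · have hP : IndPath G (n - j + 2) (seqCons (f 0) (seqCons b₀ (fun m => f (m + j)))) := by
      refine ((hp.shift (a := j) (m := n - j) (by omega)).cons (by simpa using hbj) ?_).cons
        h.tri.ab0 ?_
      · intro m h0 hm e
        have := hbm _ (by omega) (by omega) e
        omega
      · rintro (_ | m) h0 hm
        · omega
        · exact hp.not_adj (by omega) (by omega) (by omega) (by omega)
    have hend : seqCons (f 0) (seqCons b₀ (fun m => f (m + j))) (n - j + 2) = f n := by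
      simp [Nat.sub_add_cancel hj]
    refine win_apple (z := c) (s := x) (e := y) hP (by omega) ?_ h.ring.c0 ?_ ?_
      h.tri.ca2.symm ?_ h.tri.ab2.symm (not_adj_symm h.tri.cb2) ?_ (by omega)
    · rw [hend]; exact h.ne (by omega) (by omega) (by omega)
    · rw [hend]; exact h.ring.cn
    · rintro (_ | _ | m) h0 hm
      · omega
      · exact h.tri.cb0
      · exact h.ring.mid _ (by omega) (by omega)
    · exact not_adj_seqCons (hx 0 (by omega)) <| not_adj_seqCons h.tri.ab20 fun m hm =>
        hx _ (by omega)
    · exact not_adj_seqCons (not_adj_symm h.tri.ab02) <| not_adj_seqCons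
        (not_adj_symm h.tri.bb02) fun m hm => hy2 _ (by omega) (by omega)
  by_cases k2 : k ≤ i + 2
  · have hP : IndPath G (i - 2 + 2) (seqCons (f 0) (seqCons b₀ (fun m => f (i - m)))) := by
      refine ((hp.rev (b := i) (m := i - 2) (by omega) (by omega)).cons hbi ?_).cons h.tri.ab0 ?_
      · intro m h0 hm e
        have := hbm _ (by omega) (by omega) e
        omega
      · rintro (_ | m) h0 hm
        · omega
        · exact hp.not_adj (by omega) (by omega) (by omega) (by omega)
    have hend : seqCons (f 0) (seqCons b₀ (fun m => f (i - m))) (i - 2 + 2) = f 2 := by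
      simp [Nat.sub_sub_self (show 2 ≤ i by omega)]
    refine win_apple (z := f 1) (s := y) (e := x) hP (by omega) ?_
      (hp.adj_succ (i := 0) (by omega)).symm ?_ ?_ hy1 ?_ h.tri.ab2 (hx 1 (by omega)) ?_
      (by omega)
    · rw [hend]; exact h.ne (by omega) (by omega) (by omega)
    · rw [hend]; exact hp.adj_succ (by omega)
    · rintro (_ | _ | m) h0 hm
      · omega
      · exact not_adj_symm hb1
      · exact hp.not_adj (by omega) (by omega) (by omega) (by omega)
    · exact not_adj_seqCons (not_adj_symm h.tri.ab02) <| not_adj_seqCons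
        (not_adj_symm h.tri.bb02) fun m hm => hy2 _ (by omega) (by omega)
    · exact not_adj_seqCons (hx 0 (by omega)) <| not_adj_seqCons h.tri.ab20 fun m hm =>
        hx _ (by omega)
  · exact h.win_mid (w := b₀) (s := f 0) (e := c) (i := i) (j := j) (by omega) hj hbi hbj
      (fun m h1 => hbm m (by omega)) h.tri.ab0 h.ring.c0 h.tri.cb0
      (fun m h1 hm => hp.not_adj (by omega) (by omega) (by omega) (by omega))
      (fun m h1 hm => h.ring.mid m (by omega) (by omega)) (by omega)

/-- The leaf `y` is adjacent to `f 1` only, and a second neighbour `u` of `b₀` is adjacent neither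
to `x` nor to `y`. -/
theorem win_of_lean_of_free (h : Setup G c n f b₀ b₁ x y)
    (hx : ∀ i ≤ n, ¬ G.Adj x (f i)) {k : ℕ} (hy1 : G.Adj y (f 1))
    (hy : ∀ m ≤ n, G.Adj y (f m) → m = 1)
    (hb : ∀ m, 1 ≤ m → m ≤ n → ¬ G.Adj b₀ (f m)) {u : V} (hu : G.Adj b₀ u)
    (uc : ¬ G.Adj u c) (u0 : ¬ G.Adj u (f 0)) (u1 : ¬ G.Adj u (f 1)) (ux : ¬ G.Adj u x)
    (uy : ¬ G.Adj u y) {i j : ℕ} (hi : 2 ≤ i) (hij : i ≤ j) (hj : j ≤ n) (hui : G.Adj u (f i))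
    (huj : G.Adj u (f j)) (hum : ∀ m, 2 ≤ m → m ≤ n → G.Adj u (f m) → m = i ∨ m = j)
    (hk : 3 * k ≤ n + 8) : Win G k := by
  have hp := h.ring.path
  have h2 := h.two_le
  have hy2 : ∀ m, 2 ≤ m → m ≤ n → ¬ G.Adj y (f m) := fun m h1 hm e => by
    have := hy m hm e; omega
  -- Again three cycles, now passing through `u`: their lengths `n - j + 5`, `i + 3` and `j - i + 2`
  -- add up to `n + 10`.
  by_cases k1 : k + j ≤ n + 5
  · have hP : IndPath G (n - j + 3)
        (seqCons (f 0) (seqCons b₀ (seqCons u (fun m => f (m + j))))) := by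
      refine (((hp.shift (a := j) (m := n - j) (by omega)).cons (by simpa using huj) ?_).cons
        hu ?_).cons h.tri.ab0 ?_
      · intro m h0 hm e
        have := hum _ (by omega) (by omega) e
        omega
      · rintro (_ | m) h0 hm
        · omega
        · exact hb _ (by omega) (by omega)
      · rintro (_ | _ | m) h0 hm
        · omega
        · exact not_adj_symm u0
        · exact hp.not_adj (by omega) (by omega) (by omega) (by omega)
    have hend : seqCons (f 0) (seqCons b₀ (seqCons u (fun m => f (m + j)))) (n - j + 3) = f n := by
      simp [Nat.sub_add_cancel hj]
    refine win_apple (z := c) (s := x) (e := y) hP (by omega) ?_ h.ring.c0 ?_ ?_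
      h.tri.ca2.symm ?_ h.tri.ab2.symm (not_adj_symm h.tri.cb2) ?_ (by omega)
    · rw [hend]; exact h.ne (by omega) (by omega) (by omega)
    · rw [hend]; exact h.ring.cn
    · rintro (_ | _ | _ | m) h0 hm
      · omega
      · exact h.tri.cb0
      · exact not_adj_symm uc
      · exact h.ring.mid _ (by omega) (by omega)
    · exact not_adj_seqCons (hx 0 (by omega)) <| not_adj_seqCons h.tri.ab20 <|
        not_adj_seqCons (not_adj_symm ux) fun m hm => hx _ (by omega)
    · exact not_adj_seqCons (not_adj_symm h.tri.ab02) <| not_adj_seqCons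
        (not_adj_symm h.tri.bb02) <| not_adj_seqCons (not_adj_symm uy)
        fun m hm => hy2 _ (by omega) (by omega)
  by_cases k2 : k ≤ i + 3
  · have hP : IndPath G (i - 2 + 3)
        (seqCons (f 0) (seqCons b₀ (seqCons u (fun m => f (i - m))))) := by
      refine (((hp.rev (b := i) (m := i - 2) (by omega) (by omega)).cons hui ?_).cons
        hu ?_).cons h.tri.ab0 ?_
      · intro m h0 hm e
        have := hum _ (by omega) (by omega) e
        omega
      · rintro (_ | m) h0 hm
        · omega
        · exact hb _ (by omega) (by omega)
      · rintro (_ | _ | m) h0 hm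
        · omega
        · exact not_adj_symm u0
        · exact hp.not_adj (by omega) (by omega) (by omega) (by omega)
    have hend : seqCons (f 0) (seqCons b₀ (seqCons u (fun m => f (i - m)))) (i - 2 + 3) = f 2 := by
      simp [Nat.sub_sub_self hi]
    refine win_apple (z := f 1) (s := y) (e := x) hP (by omega) ?_
      (hp.adj_succ (i := 0) (by omega)).symm ?_ ?_ hy1 ?_ h.tri.ab2 (hx 1 (by omega)) ?_
      (by omega)
    · rw [hend]; exact h.ne (by omega) (by omega) (by omega)
    · rw [hend]; exact hp.adj_succ (by omega)
    · rintro (_ | _ | _ | m) h0 hm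
      · omega
      · exact not_adj_symm (hb 1 (by omega) (by omega))
      · exact not_adj_symm u1
      · exact hp.not_adj (by omega) (by omega) (by omega) (by omega)
    · exact not_adj_seqCons (not_adj_symm h.tri.ab02) <| not_adj_seqCons
        (not_adj_symm h.tri.bb02) <| not_adj_seqCons (not_adj_symm uy)
        fun m hm => hy2 _ (by omega) (by omega)
    · exact not_adj_seqCons (hx 0 (by omega)) <| not_adj_seqCons h.tri.ab20 <|
        not_adj_seqCons (not_adj_symm ux) fun m hm => hx _ (by omega)
  · exact h.win_mid (w := u) (s := b₀) (e := f 0) (i := i) (j := j) (by omega) hj hui huj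
      (fun m h1 => hum m (by omega)) hu h.tri.ab0 (not_adj_symm u0)
      (fun m h1 hm => hb m (by omega) (by omega))
      (fun m h1 hm => hp.not_adj (by omega) (by omega) (by omega) (by omega)) (by omega)

/-- The case that `u` is adjacent to `y`. -/
theorem win_of_lean_of_adj_y (h : Setup G c n f b₀ b₁ x y) (hG : Subcubic G)
    (hx : ∀ i ≤ n, ¬ G.Adj x (f i)) {k : ℕ} (hy1 : G.Adj y (f 1))
    (hy : ∀ m ≤ n, G.Adj y (f m) → m = 1)
    (hb : ∀ m, 1 ≤ m → m ≤ n → ¬ G.Adj b₀ (f m)) {u : V} (hu : G.Adj b₀ u)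
    (hun : ∀ m ≤ n, u ≠ f m) (cu : c ≠ u)
    (uc : ¬ G.Adj u c) (u0 : ¬ G.Adj u (f 0)) (u1 : ¬ G.Adj u (f 1)) (ux : ¬ G.Adj u x)
    (uy : G.Adj u y) {i : ℕ} (hi : i = 2 ∨ i = n) (hui : G.Adj u (f i))
    (hum : ∀ m, 2 ≤ m → m ≤ n → G.Adj u (f m) → m = i)
    (hk : k ≤ n + 2) : Win G k := by
  have hp := h.ring.path
  have h2 := h.two_le
  -- For `n = 2` the vertex `f 2` would have the four neighbours `c`, `f 1`, `u` and `b₁`.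
  have hn2 : n ≠ 2 := by
    rintro rfl
    have hu2 : G.Adj u (f 2) := by rcases hi with rfl | rfl <;> exact hui
    rcases hG h.ring.cn.symm ((hp.adj_iff le_rfl (by omega)).2 (by omega) : G.Adj (f 2) (f 1))
      hu2.symm (h.c_ne hx 1 (by omega)) cu (hun _ (by omega)).symm h.tri.ab1 with e | e | e
    · exact h.tri.ab21 (e ▸ h.tri.ca2.symm)
    · exact h.tri.bb12 (e ▸ hy1.symm)
    · exact h.tri.bb01 (e ▸ hu)
  -- For `i = 2` the long path runs `c, f n, …, f 2, u`, with ears `f 0, b₀` and `x, y`. For `i = n`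
  -- it is `f 1, …, f n`, with ears `f 0, c` and `y, u`.
  rcases hi with rfl | rfl
  · have hP1 : IndPath G (n - 2 + 1) (seqCons u (fun m => f (m + 2))) := by
      refine (hp.shift (a := 2) (m := n - 2) (by omega)).cons hui ?_
      intro m h0 hm e
      have := hum _ (by omega) (by omega) e
      omega
    have hP : IndPath G (n - 2 + 1 + 1)
        (seqCons c (fun m => seqCons u (fun m => f (m + 2)) (n - 2 + 1 - m))) := by
      refine (hP1.rev le_rfl le_rfl).cons ?_ ?_
      · simpa [Nat.sub_add_cancel h2] using h.ring.cn
      · intro m h0 hm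
        rcases Nat.lt_or_ge m (n - 2 + 1) with h3 | h3
        · obtain ⟨t, ht⟩ : ∃ t, n - 2 + 1 - m = t + 1 := ⟨n - 2 - m, by omega⟩
          rw [ht]
          exact h.ring.mid _ (by omega) (by omega)
        · obtain rfl : m = n - 2 + 1 := by omega
          simpa using not_adj_symm uc
    have key : ∀ {v : V}, (∀ m, 2 ≤ m → m ≤ n → ¬ G.Adj v (f m)) → ¬ G.Adj v u →
        ∀ m, 0 < m → m ≤ n - 2 + 1 + 1 → ¬ G.Adj v
          (seqCons c (fun m => seqCons u (fun m => f (m + 2)) (n - 2 + 1 - m)) m) := by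
      rintro v h3 h4 (_ | m) h0 hm
      · omega
      · have := not_adj_seqCons (n := n - 2) (f := fun m => f (m + 2)) h4
          fun m hm => h3 _ (by omega) (by omega)
        exact this _ (by omega)
    have key' : ∀ {v : V}, (∀ m, 2 ≤ m → m ≤ n → ¬ G.Adj v (f m)) → ¬ G.Adj v c →
        ∀ m, m < n - 2 + 1 + 1 → ¬ G.Adj v
          (seqCons c (fun m => seqCons u (fun m => f (m + 2)) (n - 2 + 1 - m)) m) := by
      rintro v h3 h4 (_ | m) hm
      · exact h4
      · obtain ⟨t, ht⟩ : ∃ t, n - 2 + 1 - m = t + 1 := ⟨n - 2 - m, by omega⟩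
        rw [seqCons_succ, ht]
        exact h3 _ (by omega) (by omega)
    have hend : seqCons c (fun m => seqCons u (fun m => f (m + 2)) (n - 2 + 1 - m))
        (n - 2 + 1 + 1) = u := by simp
    refine win_ext (p := f 0) (q := b₀) (x := x) (y := y) hP (by omega) h.ring.c0.symm
      (key ?_ (not_adj_symm u0)) ?_ (key' ?_ (not_adj_symm h.tri.cb0)) h.tri.ca2.symm
      (key ?_ (not_adj_symm ux)) ?_ (key' ?_ (not_adj_symm h.tri.cb2)) h.tri.ab0 h.tri.ab2
      (not_adj_symm h.tri.aa02) h.tri.ab20 (not_adj_symm h.tri.ab02) (not_adj_symm h.tri.bb02)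
      (by omega)
    · intro m hm1 hm
      exact hp.not_adj (by omega) (by omega) (by omega) (by omega)
    · rw [hend]; exact hu
    · intro m hm1 hm
      exact hb _ (by omega) hm
    · exact fun m _ hm => hx m hm
    · rw [hend]; exact uy.symm
    · intro m hm1 hm e
      have := hy _ hm e
      omega
  · have hend : f (i - 1 + 1) = f i := by rw [Nat.sub_add_cancel (by omega)]
    refine win_ext (p := f 0) (q := c) (x := y) (y := u)
      (hp.shift (a := 1) (m := i - 1) (by omega)) (by omega) (hp.adj_succ (by omega)) ?_ ?_ ?_
      hy1 ?_ ?_ ?_ h.ring.c0.symm uy.symm (not_adj_symm h.tri.ab02) (not_adj_symm h.tri.cb2)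
      u0 uc (by omega)
    · intro m h0 hm
      exact hp.not_adj (by omega) (by omega) (by omega) (by omega)
    · rw [hend]; exact h.ring.cn
    · intro m hm
      exact h.ring.mid _ (by omega) (by omega)
    · intro m h0 hm e
      have := hy _ (by omega) e
      omega
    · rw [hend]; exact hui
    · rintro (_ | m) hm
      · exact u1
      · intro e
        have := hum _ (by omega) (by omega) e
        omega

/-- The case that `u` is adjacent to `x`. -/
theorem win_of_lean_of_adj_x (h : Setup G c n f b₀ b₁ x y)
    (hx : ∀ i ≤ n, ¬ G.Adj x (f i)) {k : ℕ} (hy1 : G.Adj y (f 1))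
    (hy : ∀ m ≤ n, G.Adj y (f m) → m = 1)
    (hb : ∀ m, 1 ≤ m → m ≤ n → ¬ G.Adj b₀ (f m)) {u : V} (hu : G.Adj b₀ u)
    (uc : ¬ G.Adj u c) (u0 : ¬ G.Adj u (f 0)) (u1 : ¬ G.Adj u (f 1)) (ux : G.Adj u x)
    (uy : ¬ G.Adj u y) {i : ℕ} (hi : i = 2 ∨ i = n) (hui : G.Adj u (f i))
    (hum : ∀ m, 2 ≤ m → m ≤ n → G.Adj u (f m) → m = i)
    (hk : k ≤ n + 2) : Win G k := by
  have hp := h.ring.path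
  have h2 := h.two_le
  -- For `i = n` the long path runs `u, f n, …, f 1`, with ears `x, y` and `b₀, f 0`. Otherwise it
  -- runs `c, f n, …, f 2`, with ears `x, u` and `f 0, f 1`.
  by_cases hin : i = n
  · subst hin
    have hP : IndPath G (i - 1 + 1) (seqCons u (fun m => f (i - m))) := by
      refine (hp.rev (b := i) (m := i - 1) (by omega) (by omega)).cons hui ?_
      intro m h0 hm e
      rcases Nat.lt_or_ge (i - m) 2 with h3 | h3
      · have h4 : i - m = 1 := by omega
        exact u1 (by simpa [h4] using e)
      · have := hum _ h3 (by omega) e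
        omega
    have hend : seqCons u (fun m => f (i - m)) (i - 1 + 1) = f 1 := by
      simp [Nat.sub_sub_self (show 1 ≤ i by omega)]
    refine win_ext (p := x) (q := y) (x := b₀) (y := f 0) hP (by omega) ux.symm ?_ ?_ ?_ hu
      ?_ ?_ ?_ h.tri.ab2 h.tri.ab0.symm (not_adj_symm h.tri.ab20) h.tri.bb02 h.tri.aa02
      h.tri.ab02 (by omega)
    · rintro (_ | m) h0 hm
      · omega
      · exact hx _ (by omega)
    · rw [hend]; exact hy1
    · rintro (_ | m) hm
      · exact not_adj_symm uy
      · intro e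
        have := hy _ (by omega) e
        omega
    · rintro (_ | m) h0 hm
      · omega
      · exact hb _ (by omega) (by omega)
    · rw [hend]; exact hp.adj_succ (by omega)
    · rintro (_ | m) hm
      · exact not_adj_symm u0
      · exact hp.not_adj (by omega) (by omega) (by omega) (by omega)
  · obtain rfl : i = 2 := by omega
    have hP : IndPath G (n - 2 + 1) (seqCons c (fun m => f (n - m))) :=
      (hp.rev (b := n) (m := n - 2) (by omega) (by omega)).cons h.ring.cn
        fun m h0 hm => h.ring.mid _ (by omega) (by omega)
    have hend : seqCons c (fun m => f (n - m)) (n - 2 + 1) = f 2 := by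
      simp [Nat.sub_sub_self h2]
    refine win_ext (p := x) (q := u) (x := f 0) (y := f 1) hP (by omega) h.tri.ca2.symm ?_ ?_ ?_
      h.ring.c0.symm ?_ ?_ ?_ ux.symm (hp.adj_succ (by omega)) h.tri.aa02 (not_adj_symm u0)
      (not_adj_symm (hx 1 (by omega))) (not_adj_symm u1) (by omega)
    · rintro (_ | m) h0 hm
      · omega
      · exact hx _ (by omega)
    · rw [hend]; exact hui
    · rintro (_ | m) hm
      · exact uc
      · intro e
        have := hum _ (by omega) (by omega) e
        omega
    · rintro (_ | m) h0 hm
      · omega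
      · exact hp.not_adj (by omega) (by omega) (by omega) (by omega)
    · rw [hend]; exact hp.adj_succ (by omega)
    · rintro (_ | m) hm
      · exact not_adj_symm (h.ring.mid 1 (by omega) (by omega))
      · exact hp.not_adj (by omega) (by omega) (by omega) (by omega)

/-- With `y` tied to `f 1`, attention moves to the leg `f 0`: its leaf `b₀`, or else a second
neighbour `u` of `b₀`, supplies the attachments that split the cycle. If `u` meets the path nowhere,
then `b₀, u` is a stem for the whole cycle. -/
theorem win_of_lean_one (h : Setup G c n f b₀ b₁ x y) (hG : Subcubic G) (hM : NoPendant G)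
    (hx : ∀ i ≤ n, ¬ G.Adj x (f i)) {k : ℕ} (hy1 : G.Adj y (f 1))
    (hy : ∀ m ≤ n, G.Adj y (f m) → m = 1) (hk : 3 * k ≤ n + 8) : Win G k := by
  have hp := h.ring.path
  have h2 := h.two_le
  have hyn := h.y_ne hx
  have hcn := h.c_ne hx
  have hbn : ∀ m ≤ n, b₀ ≠ f m := by
    rintro m hm rfl
    have := (hp.adj_iff (by omega) hm).1 h.tri.ab0
    obtain rfl : m = 1 := by omega
    exact h.tri.bb02 hy1.symm
  have hby : b₀ ≠ y := by rintro rfl; exact h.tri.ab02 h.tri.ab0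
  have hb1 : ¬ G.Adj b₀ (f 1) := fun e =>
    hby (h.full hG (by omega) (by omega) hy1.symm hyn e.symm hbn)
  by_cases hw : ∃ m ≤ n, 1 ≤ m ∧ G.Adj b₀ (f m)
  · exact h.win_of_lean_of_adj hG hx hy1 hy hbn hb1 hw hk
  have hb : ∀ m, 1 ≤ m → m ≤ n → ¬ G.Adj b₀ (f m) := fun m h1 hm e => hw ⟨m, hm, h1, e⟩
  have f01 : G.Adj (f 0) (f 1) := hp.adj_succ (by omega)
  have hcb : c ≠ b₀ := by rintro rfl; exact h.tri.ab20 h.tri.ca2.symm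
  obtain ⟨u, hu0, hu⟩ := hM h.tri.ab0
  have hun : ∀ m ≤ n, u ≠ f m := by
    rintro m hm rfl
    rcases Nat.eq_zero_or_pos m with rfl | h0
    · exact hu0 rfl
    · exact hb m h0 hm hu
  have hux : u ≠ x := by rintro rfl; exact h.tri.ab20 hu.symm
  have huy : u ≠ y := by rintro rfl; exact h.tri.bb02 hu
  have huc : u ≠ c := by rintro rfl; exact h.tri.cb0 hu.symm
  have uc : ¬ G.Adj u c := fun e => by
    rcases h.c_full hG e.symm with e | e | e
    · exact hun _ (by omega) e
    · exact hun _ le_rfl e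
    · exact hux e
  have u0 : ¬ G.Adj u (f 0) := fun e => by
    rcases hG h.ring.c0.symm f01 h.tri.ab0 (hcn _ (by omega)) hcb (hbn _ (by omega)).symm e.symm
      with e | e | e
    · exact huc e
    · exact hun _ (by omega) e
    · exact hu.ne e.symm
  have u1 : ¬ G.Adj u (f 1) := fun e =>
    huy (h.full hG (by omega) (by omega) hy1.symm hyn e.symm hun)
  by_cases hw' : ∃ m ≤ n, 2 ≤ m ∧ G.Adj u (f m)
  · obtain ⟨i, j, hi, hij, hj, hui, huj, hum⟩ := h.attach hG hu.symm 2 (fun m _ => hbn m) hw'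
    -- Here `f 0` is itself the centre of a tripod with legs `c`, `f 1`, `b₀`, whose third leg is
    -- free and whose leaf `u` does not lean. Otherwise `i = 2` or `j = n`.
    by_cases hth : 3 ≤ i ∧ j + 1 ≤ n
    · have S : Setup G (f 0) n (seqCons c (fun m => f (n - m))) (f n) (f 2) b₀ u := by
        have hn0 : n = n - 1 + 1 := by omega
        have hend : seqCons c (fun m => f (n - m)) n = f 1 := by
          rw [hn0]; simp
        refine ⟨⟨?_, h.ring.c0.symm, ?_, ?_⟩, ?_⟩
        · have := (hp.rev (b := n) (m := n - 1) (by omega) (by omega)).cons h.ring.cn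
            fun m h0 hm => h.ring.mid _ (by omega) (by omega)
          rwa [← hn0] at this
        · rw [hend]; exact f01
        · rintro (_ | m) h0 hm
          · omega
          · exact hp.not_adj (by omega) (by omega) (by omega) (by omega)
        · rw [hend, seqCons_zero]
          exact
          { ca0 := h.ring.c0.symm
            ca1 := f01
            ca2 := h.tri.ab0
            ab0 := h.ring.cn
            ab1 := hp.adj_succ (by omega)
            ab2 := hu
            aa01 := h.ring.mid 1 (by omega) (by omega)
            aa02 := h.tri.cb0
            aa12 := not_adj_symm hb1
            ab01 := h.ring.mid 2 (by omega) (by omega)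
            ab02 := not_adj_symm uc
            ab10 := hp.not_adj (by omega) (by omega) (by omega) (by omega)
            ab12 := not_adj_symm u1
            ab20 := hb _ (by omega) le_rfl
            ab21 := hb _ (by omega) (by omega)
            bb01 := hp.not_adj (by omega) (by omega) (by omega) (by omega)
            bb02 := fun e => by have := hum n (by omega) le_rfl e.symm; omega
            bb12 := fun e => by have := hum 2 (by omega) (by omega) e.symm; omega
            cb0 := h.tri.aa01
            cb1 := hp.not_adj (by omega) (by omega) (by omega) (by omega)
            cb2 := not_adj_symm u0 }
      refine S.win_of_not_lean hG ?_ ?_ ?_ (by omega)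
      · rintro (_ | m) hm
        · exact not_adj_symm h.tri.cb0
        · exact hb _ (by omega) (by omega)
      · intro e
        have := hum n (by omega) le_rfl e
        omega
      · intro e
        have hn1 : n - 1 = n - 2 + 1 := by omega
        rw [hn1, seqCons_succ] at e
        have := hum _ (by omega) (by omega) e
        omega
    · by_cases uxy : G.Adj u x ∨ G.Adj u y
      -- An edge from `u` to `x` or `y`, together with the edge to `b₀`, leaves room for only one
      -- neighbour on the path.
      · have hji : j = i := by
          by_contra hne
          have h3 : ∀ v, G.Adj u v → v ≠ b₀ → ∃ m ≤ n, v = f m := by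
            intro v huv hvb
            rcases hG hui huj hu.symm (h.ne (by omega) hj (by omega)) (hbn _ (by omega)).symm
              (hbn _ hj).symm huv with e | e | e
            · exact ⟨i, by omega, e⟩
            · exact ⟨j, hj, e⟩
            · exact absurd e hvb
          rcases uxy with e | e
          · obtain ⟨m, hm, e'⟩ := h3 x e (by rintro rfl; exact h.tri.cb0 h.tri.ca2)
            exact h.x_ne m hm e'
          · obtain ⟨m, hm, e'⟩ := h3 y e hby.symm
            exact hyn m hm e'
        subst hji
        have hum' : ∀ m, 2 ≤ m → m ≤ n → G.Adj u (f m) → m = j := fun m h1 hm e => by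
          have := hum m h1 hm e; omega
        have hnot : ¬ (G.Adj u x ∧ G.Adj u y) := by
          rintro ⟨e1, e2⟩
          rcases hG e1 e2 hu.symm h.tri.ab2.ne (by rintro rfl; exact h.tri.cb0 h.tri.ca2)
            hby.symm hui with e | e | e
          · exact h.x_ne _ hj e.symm
          · exact hyn _ hj e.symm
          · exact hbn _ hj e.symm
        by_cases uy : G.Adj u y
        · exact h.win_of_lean_of_adj_y hG hx hy1 hy hb hu hun huc.symm uc u0 u1
            (fun e => hnot ⟨e, uy⟩) uy (i := j) (by omega) hui hum' (by omega)
        · exact h.win_of_lean_of_adj_x hx hy1 hy hb hu uc u0 u1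
            (uxy.resolve_right uy) uy (i := j) (by omega) hui hum' (by omega)
      · push Not at uxy
        exact h.win_of_lean_of_free hx hy1 hy hb hu uc u0 u1 uxy.1 uxy.2 hi hij hj hui huj hum hk
  · have hu2 : ∀ m ≤ n, ¬ G.Adj u (f m) := by
      rintro (_ | _ | m) hm e
      · exact u0 e
      · exact u1 e
      · exact hw' ⟨_, hm, by omega, e⟩
    have hP : IndPath G (n - 1 + 1) (seqCons c (fun m => f (n - m))) :=
      (hp.rev (b := n) (m := n - 1) (by omega) (by omega)).cons h.ring.cn
        fun m h0 hm => h.ring.mid _ (by omega) (by omega)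
    have hend : seqCons c (fun m => f (n - m)) (n - 1 + 1) = f 1 := by
      simp [Nat.sub_sub_self (show 1 ≤ n by omega)]
    refine win_apple (z := f 0) (s := b₀) (e := u) hP (by omega) ?_ h.ring.c0.symm ?_ ?_
      h.tri.ab0.symm ?_ hu.symm u0 ?_ (by omega)
    · rw [hend]; exact hcn _ (by omega)
    · rw [hend]; exact f01
    · rintro (_ | m) h0 hm
      · omega
      · exact hp.not_adj (by omega) (by omega) (by omega) (by omega)
    · exact not_adj_seqCons (not_adj_symm h.tri.cb0) fun m hm => hb _ (by omega) (by omega)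
    · exact not_adj_seqCons uc fun m hm => hu2 _ (by omega)

/-! ### Rerouting the cycle through the third leg -/

/-- Reroute the cycle through the legs `x` and `f n`, entering the path from `y` at `f j`. -/
theorem switch (h : Setup G c n f b₀ b₁ x y) {j : ℕ} (h1 : 1 ≤ j) (hj : j ≤ n)
    (hx : ∀ m, j ≤ m → m ≤ n → ¬ G.Adj x (f m)) (hyj : G.Adj y (f j))
    (hy : ∀ m, j < m → m ≤ n → ¬ G.Adj y (f m)) :
    Setup G c (n - j + 2) (seqCons x (seqCons y (fun m => f (m + j)))) y b₁ (f 0) b₀ where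
  ring :=
    { path := by
        refine ((h.ring.path.shift (a := j) (m := n - j) (by omega)).cons (by simpa using hyj)
          fun m h0 hm => hy _ (by omega) (by omega)).cons h.tri.ab2 ?_
        rintro (_ | m) h0 hm
        · omega
        · exact hx _ (by omega) (by omega)
      c0 := h.tri.ca2
      cn := by simpa [Nat.sub_add_cancel hj] using h.ring.cn
      mid := by
        rintro (_ | _ | m) h0 hm
        · omega
        · exact h.tri.cb2
        · exact h.ring.mid _ (by omega) (by omega) }
  tri := by simpa [Nat.sub_add_cancel hj] using h.tri.swap02

theorem not_adj_switch (h : Setup G c n f b₀ b₁ x y) {j : ℕ} (h1 : 2 ≤ j) (hj : j ≤ n) :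
    ∀ m ≤ n - j + 2, ¬ G.Adj (f 0) (seqCons x (seqCons y (fun m => f (m + j))) m) :=
  not_adj_seqCons h.tri.aa02 <| not_adj_seqCons h.tri.ab02 fun m hm =>
    h.ring.path.not_adj (by omega) (by omega) (by omega) (by omega)

/-- The cycle `y, x, c, f n, …, f j` with stem `f (j - 1), f (j - 2)`. -/
theorem win_right_stem (h : Setup G c n f b₀ b₁ x y) (hx : ∀ i ≤ n, ¬ G.Adj x (f i)) {j k : ℕ}
    (h4 : 4 ≤ j) (hj : j < n) (hyj : G.Adj y (f j))
    (hy : ∀ m ≤ n, G.Adj y (f m) → m = 1 ∨ m = j) (hk : k + j ≤ n + 4) : Win G k := by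
  have hp := h.ring.path
  have hP : IndPath G (n - j - 1 + 3)
      (seqCons y (seqCons x (seqCons c (fun m => f (n - m))))) := by
    refine (((hp.rev (b := n) (m := n - j - 1) (by omega) (by omega)).cons h.ring.cn
      fun m h0 hm => h.ring.mid _ (by omega) (by omega)).cons h.tri.ca2.symm ?_).cons
      h.tri.ab2.symm ?_
    · rintro (_ | m) h0 hm
      · omega
      · exact hx _ (by omega)
    · rintro (_ | _ | m) h0 hm
      · omega
      · exact not_adj_symm h.tri.cb2
      · intro e
        have := hy _ (by omega) e
        omega
  have hend : seqCons y (seqCons x (seqCons c (fun m => f (n - m)))) (n - j - 1 + 3) =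
      f (j + 1) := by
    show f (n - (n - j - 1)) = _
    congr 1
    omega
  refine win_apple (z := f j) (s := f (j - 1)) (e := f (j - 2)) hP (by omega) ?_ hyj.symm ?_ ?_
    ((hp.adj_iff (by omega) (by omega)).2 (by omega)) ?_
    ((hp.adj_iff (by omega) (by omega)).2 (by omega))
    (hp.not_adj (by omega) (by omega) (by omega) (by omega)) ?_ (by omega)
  · rw [hend]; exact h.y_ne hx _ (by omega)
  · rw [hend]; exact hp.adj_succ hj
  · rintro (_ | _ | _ | m) h0 hm
    · omega
    · exact not_adj_symm (hx j (by omega))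
    · exact not_adj_symm (h.ring.mid j (by omega) (by omega))
    · exact hp.not_adj (by omega) (by omega) (by omega) (by omega)
  · refine not_adj_seqCons (fun e => ?_) <| not_adj_seqCons (not_adj_symm (hx _ (by omega))) <|
      not_adj_seqCons (not_adj_symm (h.ring.mid _ (by omega) (by omega))) fun m hm =>
        hp.not_adj (by omega) (by omega) (by omega) (by omega)
    have := hy _ (by omega) e.symm
    omega
  · refine not_adj_seqCons (fun e => ?_) <| not_adj_seqCons (not_adj_symm (hx _ (by omega))) <|
      not_adj_seqCons (not_adj_symm (h.ring.mid _ (by omega) (by omega))) fun m hm =>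
        hp.not_adj (by omega) (by omega) (by omega) (by omega)
    have := hy _ (by omega) e.symm
    omega

/-- If `y` is adjacent to `f 1`, then either we are done or the cycle can be rerouted. -/
theorem win_or_switch (h : Setup G c n f b₀ b₁ x y) (hG : Subcubic G) (hM : NoPendant G)
    (hx : ∀ i ≤ n, ¬ G.Adj x (f i)) {k : ℕ} (hy1 : G.Adj y (f 1)) (hk : 3 * k ≤ n + 8) :
    Win G k ∨ ∃ j, 2 ≤ j ∧ j ≤ 3 ∧ j < n ∧
      Setup G c (n - j + 2) (seqCons x (seqCons y (fun m => f (m + j)))) y b₁ (f 0) b₀ := by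
  have h2 := h.two_le
  obtain ⟨i, j, h0, hij, hj, hyi, hyj, hy⟩ := h.attach_y hG ⟨1, by omega, hy1⟩
  obtain rfl : i = 1 := by
    have := hy 1 (by omega) hy1
    omega
  rcases Nat.lt_or_ge 1 j with h1 | h1
  · rcases Nat.lt_or_ge j 4 with h4 | h4
    · refine Or.inr ⟨j, by omega, by omega, by omega, h.switch (by omega) (by omega)
        (fun m _ hm => hx m hm) hyj fun m h3 hm e => ?_⟩
      have := hy m hm e
      omega
    -- The two cycles through `y` have lengths `n - j + 4` and `j + 1`, with sum `n + 5`, so one is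
    -- long enough. For `j ≤ 3` the second may be too short, but rerouting then decreases `n` by at
    -- most one.
    · by_cases k1 : k + j ≤ n + 4
      · exact Or.inl (h.win_right_stem hx h4 (by omega) hyj hy k1)
      · exact Or.inl (h.win_mid_y hx (by omega) h0 (by omega) hyi hyj hy (by omega))
  · refine Or.inl (h.win_of_lean_one hG hM hx hy1 (fun m hm e => ?_) hk)
    have := hy m hm e
    omega

/-- The case that the leaf `b₁` lies on the path. -/
theorem win_of_leaf_on_path (h : Setup G c n f b₀ b₁ x y) (hG : Subcubic G) (hM : NoPendant G)
    (hx : ∀ i ≤ n, ¬ G.Adj x (f i)) {k : ℕ} (hb : f (n - 1) = b₁) (hk : 3 * k ≤ n + 8) :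
    Win G k := by
  by_cases hy1 : G.Adj y (f 1)
  · rcases h.win_or_switch hG hM hx hy1 hk with hw | ⟨j, hj2, hj3, hjn, S⟩
    · exact hw
    -- After the switch the third leaf is `b₀`, while the second and the penultimate path vertices
    -- are `y` and `b₁`. Leaves are pairwise nonadjacent, so `b₀` leans at neither end.
    · refine S.win_of_not_lean hG (h.not_adj_switch hj2 hjn.le) h.tri.bb02 ?_ (by omega)
      obtain ⟨t, ht⟩ : ∃ t, n - j + 2 - 1 = t + 2 := ⟨n - j - 1, by omega⟩
      have ht' : t + j = n - 1 := by omega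
      rw [ht, seqCons_succ, seqCons_succ]
      show ¬ G.Adj b₀ (f (t + j))
      rw [ht', hb]
      exact h.tri.bb01
  · exact h.win_of_not_lean hG hx hy1 (by rw [hb]; exact not_adj_symm h.tri.bb12) (by omega)

/-- The first switch puts the leaf `y` on the path next to the leg `x`, so the new leaf `b₀` cannot
lean at that end; a second switch settles the other end. Each switch decreases `n` by at most one,
hence the constants 7, 8 and 10. -/
theorem win_of_lean (h : Setup G c n f b₀ b₁ x y) (hG : Subcubic G) (hM : NoPendant G)
    (hx : ∀ i ≤ n, ¬ G.Adj x (f i)) {k : ℕ} (hy1 : G.Adj y (f 1)) (hk : 3 * k ≤ n + 7) :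
    Win G k := by
  rcases h.win_or_switch (k := k) hG hM hx hy1 (by omega) with hw | ⟨j, hj2, hj3, hjn, S⟩
  · exact hw
  · refine S.rev.win_of_leaf_on_path hG hM
      (fun m _ => h.not_adj_switch hj2 hjn.le (n - j + 2 - m) (by omega)) ?_ (by omega)
    show seqCons x (seqCons y fun m => f (m + j)) (n - j + 2 - (n - j + 2 - 1)) = y
    have : n - j + 2 - (n - j + 2 - 1) = 1 := by omega
    rw [this]
    rfl

/-- The case that the third leg `x` has no neighbour on the cycle except the centre. -/
theorem win_of_free (h : Setup G c n f b₀ b₁ x y) (hG : Subcubic G) (hM : NoPendant G)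
    (hx : ∀ i ≤ n, ¬ G.Adj x (f i)) {k : ℕ} (hk : 3 * k ≤ n + 7) : Win G k := by
  by_cases hl : G.Adj y (f 1)
  · exact h.win_of_lean hG hM hx hl hk
  by_cases hr : G.Adj y (f (n - 1))
  · exact h.rev.win_of_lean hG hM (fun m _ => hx (n - m) (by omega)) hr hk
  · exact h.win_of_not_lean hG hx hl hr (by omega)

/-! ### Third leg attached to the path -/

/-- The cycle `c, f 0, …, f i, x` with stem `f n, f (n - 1)`. -/
theorem win_before (h : Setup G c n f b₀ b₁ x y) {i k : ℕ} (hi : 1 ≤ i) (hin : i + 3 ≤ n)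
    (hxi : G.Adj x (f i)) (hx : ∀ m < i, ¬ G.Adj x (f m)) (hxn : ¬ G.Adj x (f (n - 1)))
    (hk : k ≤ i + 3) : Win G k := by
  have hp := h.ring.path
  refine win_apple (z := c) (s := f n) (e := f (n - 1))
    ((hp.rev (b := i) (m := i) (by omega) le_rfl).cons hxi fun m h0 hm => hx _ (by omega))
    (by omega) ?_ h.tri.ca2 ?_ ?_ h.ring.cn.symm ?_ ((hp.adj_iff (by omega) le_rfl).2 (by omega))
    ?_ ?_ (by omega)
  · simpa using h.x_ne 0 (by omega)
  · simpa using h.ring.c0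
  · rintro (_ | m) h0 hm
    · omega
    · exact h.ring.mid _ (by omega) (by omega)
  · exact not_adj_seqCons h.tri.aa12 fun m hm =>
      hp.not_adj (by omega) (by omega) (by omega) (by omega)
  · exact not_adj_symm (h.ring.mid _ (by omega) (by omega))
  · exact not_adj_seqCons (not_adj_symm hxn) fun m hm =>
      hp.not_adj (by omega) (by omega) (by omega) (by omega)

theorem win_after (h : Setup G c n f b₀ b₁ x y) {j k : ℕ} (hj : 3 ≤ j) (hjn : j < n)
    (hxj : G.Adj x (f j)) (hx : ∀ m, j < m → m ≤ n → ¬ G.Adj x (f m)) (hx1 : ¬ G.Adj x (f 1))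
    (hk : k + j ≤ n + 3) : Win G k := by
  refine h.rev.win_before (i := n - j) (by omega) (by omega) ?_
    (fun m hm => hx (n - m) (by omega) (by omega)) ?_ (by omega)
  · rwa [Nat.sub_sub_self hjn.le]
  · rwa [Nat.sub_sub_self (by omega)]

/-- The cycle through the legs `f 0` and `x`. -/
theorem restrict (h : Setup G c n f b₀ b₁ x y) {i : ℕ} (hin : i < n)
    (hxi : G.Adj x (f i)) (hx : ∀ m < i, ¬ G.Adj x (f m)) :
    Setup G c (i + 1) (seqCons x (fun m => f (i - m))) y b₀ (f n) b₁ where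
  ring :=
    { path := (h.ring.path.rev (b := i) (m := i) (by omega) le_rfl).cons hxi
        fun m h0 hm => hx _ (by omega)
      c0 := h.tri.ca2
      cn := by simpa using h.ring.c0
      mid := by
        rintro (_ | m) h0 hm
        · omega
        · exact h.ring.mid _ (by omega) (by omega) }
  tri := by simpa using h.tri.swap01.swap02

/-- The third leg has three neighbours on the cycle. -/
theorem win_of_two (h : Setup G c n f b₀ b₁ x y) (hG : Subcubic G) (hM : NoPendant G)
    {i j k : ℕ} (hi : 2 ≤ i) (hij : i < j) (hjn : j < n) (hxi : G.Adj x (f i))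
    (hxj : G.Adj x (f j)) (hx : ∀ m ≤ n, G.Adj x (f m) → m = i ∨ m = j)
    (hk : 3 * k ≤ n + 5) : Win G k := by
  have hp := h.ring.path
  have hx' : ∀ m ≤ n, m ≠ i → m ≠ j → ¬ G.Adj x (f m) := fun m hm h1 h2 e => by
    have := hx m hm e
    omega
  -- The cycles cut off by `x` have lengths `n - j + 3`, `j - i + 2` and `i + 3`. Only the stem of
  -- the last one causes trouble, when `j = n - 1`.
  by_cases k1 : k + j ≤ n + 3
  · exact h.win_after (by omega) hjn hxj
      (fun m h1 hm => hx' m hm (by omega) (by omega)) (hx' 1 (by omega) (by omega) (by omega)) k1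
  by_cases k2 : i + 2 ≤ j ∧ k + i ≤ j + 2
  · exact h.win_mid k2.1 hjn.le hxi hxj (fun m _ => hx m) h.tri.ca2 h.ring.c0.symm h.tri.aa02
      (fun m _ _ => h.ring.mid m (by omega) (by omega))
      (fun m _ _ => hp.not_adj (by omega) (by omega) (by omega) (by omega)) k2.2
  by_cases hj : j + 2 ≤ n
  · exact h.win_before (by omega) (by omega) hxi
      (fun m hm => hx' m (by omega) (by omega) (by omega))
      (hx' _ (by omega) (by omega) (by omega)) (by omega)
  -- For `j = n - 1` the stem `f n, f (n - 1)` fails, since `x` is adjacent to `f (n - 1)`. If `i`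
  -- is close to `j`, the cycle `c, f 0, …, f i, x` is nearly the whole cycle, and `f n` is a free
  -- third leg for it. Otherwise `f (i + 1), f (i + 2)` is a stem attached at `f i`.
  by_cases hj' : j < i + 3
  · refine (h.restrict (by omega) hxi fun m hm =>
      hx' m (by omega) (by omega) (by omega)).win_of_free hG hM ?_ (by omega)
    exact not_adj_seqCons h.tri.aa12 fun m hm =>
      hp.not_adj (by omega) (by omega) (by omega) (by omega)
  · have hP : IndPath G (i - 1 + 2) (seqCons x (seqCons c f)) := by
      refine (IndPath.cons (n := i - 1) (fun a b hab hb => hp a b hab (by omega)) h.ring.c0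
        fun m h0 hm => h.ring.mid m h0 (by omega)).cons h.tri.ca2.symm ?_
      rintro (_ | m) h0 hm
      · omega
      · exact hx' m (by omega) (by omega) (by omega)
    refine win_apple (z := f i) (s := f (i + 1)) (e := f (i + 2)) hP (by omega) ?_ hxi.symm ?_ ?_
      (hp.adj_succ (by omega)).symm ?_ (hp.adj_succ (by omega)).symm
      (hp.not_adj (by omega) (by omega) (by omega) (by omega)) ?_ (by omega)
    · exact h.x_ne (i - 1) (by omega)
    · exact (hp.adj_iff (by omega) (by omega)).2 (by omega)
    · rintro (_ | _ | m) h0 hm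
      · omega
      · exact not_adj_symm (h.ring.mid _ (by omega) (by omega))
      · exact hp.not_adj (by omega) (by omega) (by omega) (by omega)
    · exact not_adj_seqCons (not_adj_symm (hx' _ (by omega) (by omega) (by omega))) <|
        not_adj_seqCons (not_adj_symm (h.ring.mid _ (by omega) (by omega))) fun m hm =>
          hp.not_adj (by omega) (by omega) (by omega) (by omega)
    · exact not_adj_seqCons (not_adj_symm (hx' _ (by omega) (by omega) (by omega))) <|
        not_adj_seqCons (not_adj_symm (h.ring.mid _ (by omega) (by omega))) fun m hm =>
          hp.not_adj (by omega) (by omega) (by omega) (by omega)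

/-! ### The square `c, f 0, f 1, x` -/

/-- If `x` is adjacent to `f 1`, the cycle can be rerouted through `x` instead of `f 0`. -/
theorem swap_square (h : Setup G c n f b₀ b₁ x y) (hx1 : G.Adj x (f 1))
    (hx : ∀ m ≤ n, G.Adj x (f m) → m = 1) :
    Setup G c n (seqCons x (fun m => f (m + 1))) y b₁ (f 0) b₀ := by
  obtain ⟨t, rfl⟩ : ∃ t, n = t + 1 := ⟨n - 1, by have := h.two_le; omega⟩
  refine ⟨⟨?_, h.tri.ca2, h.ring.cn, ?_⟩, h.tri.swap02⟩
  · refine (h.ring.path.shift (a := 1) (m := t) (by omega)).cons hx1 fun m h0 hm e => ?_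
    have := hx _ (by omega) e
    omega
  · rintro (_ | m) h0 hm
    · omega
    · exact h.ring.mid _ (by omega) (by omega)

theorem y_ne_of_square (h : Setup G c n f b₀ b₁ x y) (hx : ∀ m ≤ n, G.Adj x (f m) → m = 1) :
    ∀ m ≤ n, y ≠ f m := by
  rintro m hm rfl
  have h2 := h.two_le
  obtain rfl := hx m hm h.tri.ab2
  exact h.tri.ab02 (h.ring.path.adj_succ (by omega))

/-- The three neighbours of `f 1` are already `f 0`, `f 2` and `x`. -/
theorem not_adj_one_of_square (h : Setup G c n f b₀ b₁ x y) (hG : Subcubic G)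
    (hx1 : G.Adj x (f 1)) {v : V} (hv : ∀ m ≤ n, v ≠ f m) (hvx : v ≠ x) : ¬ G.Adj v (f 1) := by
  have h2 := h.two_le
  exact fun e => hvx (h.full hG (by omega) (by omega) hx1.symm h.x_ne e.symm hv)

theorem b_ne_of_square (h : Setup G c n f b₀ b₁ x y) (hx1 : G.Adj x (f 1)) :
    ∀ m ≤ n, b₀ ≠ f m := by
  rintro m hm rfl
  have := (h.ring.path.adj_iff (by omega) hm).1 h.tri.ab0
  obtain rfl : m = 1 := by omega
  exact h.tri.ab20 hx1

/-- The leg `x` is adjacent to `f 1`, and its leaf `y` is attached to the path before `b₀` is. -/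
theorem win_of_square_adj (h : Setup G c n f b₀ b₁ x y) (hG : Subcubic G) (hM : NoPendant G)
    (hx1 : G.Adj x (f 1)) (hx : ∀ m ≤ n, G.Adj x (f m) → m = 1) {i j k : ℕ} (hi : 1 ≤ i)
    (hij : i ≤ j) (hj : j + 1 ≤ n) (hyi : G.Adj y (f i)) (hyj : G.Adj y (f j))
    (hy : ∀ m ≤ n, G.Adj y (f m) → m = i ∨ m = j)
    (hb : ∀ m, 1 ≤ m → m ≤ i → ¬ G.Adj b₀ (f m)) (hk : 5 * k ≤ n + 15) : Win G k := by
  have hp := h.ring.path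
  have h2 := h.two_le
  have hy1 : ¬ G.Adj y (f 1) :=
    h.not_adj_one_of_square hG hx1 (h.y_ne_of_square hx) h.tri.ab2.ne'
  have hi1 : i ≠ 1 := by rintro rfl; exact hy1 hyi
  have hx2 : ∀ m, 2 ≤ m → m ≤ n → ¬ G.Adj x (f m) := fun m h1 hm e => by
    have := hx m hm e
    omega
  -- The right cycle has the free third leg `f 0` and gives only a third of its length; the left
  -- cycle has stem `f 0, b₀` and the middle one `x, c`. Hence the budget `3 + 1 + 1 = 5`.
  by_cases k1 : 3 * k + j ≤ n + 9
  · refine (h.switch (by omega) (by omega) (fun m h1 => hx2 m (by omega)) hyj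
      fun m h1 hm e => ?_).win_of_free hG hM (h.not_adj_switch (by omega) (by omega)) (by omega)
    have := hy m hm e
    omega
  by_cases k2 : k ≤ i + 2
  · have hP : IndPath G (i - 2 + 2) (seqCons x (seqCons y (fun m => f (i - m)))) := by
      refine ((hp.rev (b := i) (m := i - 2) (by omega) (by omega)).cons hyi ?_).cons h.tri.ab2 ?_
      · intro m h0 hm e
        have := hy _ (by omega) e
        omega
      · rintro (_ | m) h0 hm
        · omega
        · exact hx2 _ (by omega) (by omega)
    have hend : seqCons x (seqCons y (fun m => f (i - m))) (i - 2 + 2) = f 2 := by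
      simp [Nat.sub_sub_self (show 2 ≤ i by omega)]
    refine win_apple (z := f 1) (s := f 0) (e := b₀) hP (by omega) ?_ hx1.symm ?_ ?_
      (hp.adj_succ (by omega)) ?_ h.tri.ab0.symm (hb 1 (by omega) (by omega)) ?_ (by omega)
    · rw [hend]; exact h.x_ne _ (by omega)
    · rw [hend]; exact hp.adj_succ (by omega)
    · rintro (_ | _ | m) h0 hm
      · omega
      · exact not_adj_symm hy1
      · exact hp.not_adj (by omega) (by omega) (by omega) (by omega)
    · exact not_adj_seqCons h.tri.aa02 <| not_adj_seqCons h.tri.ab02 fun m hm =>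
        hp.not_adj (by omega) (by omega) (by omega) (by omega)
    · exact not_adj_seqCons (not_adj_symm h.tri.ab20) <| not_adj_seqCons h.tri.bb02 fun m hm =>
        hb _ (by omega) (by omega)
  · exact h.win_mid (by omega) (by omega) hyi hyj (fun m _ => hy m) h.tri.ab2 h.tri.ca2 h.tri.cb2
      (fun m _ _ => hx2 m (by omega) (by omega))
      (fun m _ _ => h.ring.mid m (by omega) (by omega)) (by omega)

/-- The leg `x` is adjacent to `f 1`, and neither `y` nor `b₀` is attached to the path. -/
theorem win_of_square_free (h : Setup G c n f b₀ b₁ x y) (hG : Subcubic G) (hM : NoPendant G)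
    (hc : ∀ m ≤ n, c ≠ f m) (hx1 : G.Adj x (f 1)) (hx : ∀ m ≤ n, G.Adj x (f m) → m = 1)
    (hy : ∀ m ≤ n, ¬ G.Adj y (f m)) (hb : ∀ m, 1 ≤ m → m ≤ n → ¬ G.Adj b₀ (f m)) {k : ℕ}
    (hk : 7 * k ≤ n + 22) : Win G k := by
  have hp := h.ring.path
  have h2 := h.two_le
  have hbn := h.b_ne_of_square hx1
  have hx2 : ∀ m, 2 ≤ m → m ≤ n → ¬ G.Adj x (f m) := fun m h1 hm e => by
    have := hx m hm e
    omega
  obtain ⟨u, hux, hu⟩ := hM h.tri.ab2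
  have hun : ∀ m ≤ n, u ≠ f m := by
    rintro m hm rfl
    exact hy m hm hu
  have huc : u ≠ c := by rintro rfl; exact h.tri.cb2 hu.symm
  have uc : ¬ G.Adj u c := fun e => by
    rcases h.c_full hG e.symm with e | e | e
    · exact hun _ (by omega) e
    · exact hun _ le_rfl e
    · exact hux e
  have u1 : ¬ G.Adj u (f 1) := h.not_adj_one_of_square hG hx1 hun hux
  have hcb : c ≠ b₀ := by rintro rfl; exact h.tri.ab20 h.tri.ca2.symm
  have u0 : ¬ G.Adj u (f 0) := fun e => by
    rcases hG h.ring.c0.symm (hp.adj_succ (by omega)) h.tri.ab0 (hc _ (by omega)) hcb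
      (hbn _ (by omega)).symm e.symm with e | e | e
    · exact huc e
    · exact hun _ (by omega) e
    · exact h.tri.bb02 (e ▸ hu.symm)
  have hcy : c ≠ y := by rintro rfl; exact h.tri.ab02 h.ring.c0.symm
  have ux : ¬ G.Adj u x := fun e => by
    rcases hG h.tri.ca2.symm hx1 h.tri.ab2 (hc _ (by omega)) hcy
      (h.y_ne_of_square hx _ (by omega)).symm e.symm with e | e | e
    · exact huc e
    · exact hun _ (by omega) e
    · exact hu.ne e.symm
  by_cases hw : ∃ m ≤ n, 2 ≤ m ∧ G.Adj u (f m)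
  · obtain ⟨i, j, hi, hij, hj, hui, huj, hum⟩ := h.attach hG hu.symm 2
      (fun m _ => h.y_ne_of_square hx m) hw
    -- The right cycle has centre `c` and the left one centre `f 1`. Both go through `x, y, u` and
    -- have the free third leg `f 0`, so each costs a factor 3. The middle cycle, closed by `u`, has
    -- stem `y, x`. This is the budget 7.
    by_cases k1 : 3 * k + j ≤ n + 10
    · have S : Setup G c (n - j + 3) (seqCons x (seqCons y (seqCons u (fun m => f (m + j)))))
          y b₁ (f 0) b₀ := by
        refine ⟨⟨?_, h.tri.ca2, ?_, ?_⟩, ?_⟩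
        · refine (((hp.shift (a := j) (m := n - j) (by omega)).cons (by simpa using huj)
            ?_).cons hu ?_).cons h.tri.ab2 ?_
          · intro m h0 hm e
            have := hum _ (by omega) (by omega) e
            omega
          · rintro (_ | m) h0 hm
            · omega
            · exact hy _ (by omega)
          · rintro (_ | _ | m) h0 hm
            · omega
            · exact not_adj_symm ux
            · exact hx2 _ (by omega) (by omega)
        · simpa [Nat.sub_add_cancel hj] using h.ring.cn
        · rintro (_ | _ | _ | m) h0 hm
          · omega
          · exact h.tri.cb2
          · exact not_adj_symm uc
          · exact h.ring.mid _ (by omega) (by omega)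
        · simpa [Nat.sub_add_cancel hj] using h.tri.swap02
      refine S.win_of_free hG hM ?_ (by omega)
      exact not_adj_seqCons h.tri.aa02 <| not_adj_seqCons h.tri.ab02 <|
        not_adj_seqCons (not_adj_symm u0) fun m hm =>
          hp.not_adj (by omega) (by omega) (by omega) (by omega)
    by_cases k2 : 3 * k ≤ i + 8
    · have hn2 : n ≠ 2 := by
        rintro rfl
        obtain rfl : i = 2 := by omega
        rcases hG h.ring.cn.symm
          ((hp.adj_iff le_rfl (by omega)).2 (by omega) : G.Adj (f 2) (f 1)) hui.symm
          (hc _ (by omega)) huc.symm (hun _ (by omega)).symm h.tri.ab1 with e | e | e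
        · exact h.tri.ab21 (e ▸ h.tri.ca2.symm)
        · exact h.tri.ab21 (e ▸ hx1)
        · exact h.tri.bb12 (e ▸ hu.symm)
      have hend : seqCons x (seqCons y (seqCons u (fun m => f (i - m)))) (i - 2 + 3) = f 2 := by
        simp [Nat.sub_sub_self hi]
      have S : Setup G (f 1) (i - 2 + 3)
          (seqCons x (seqCons y (seqCons u (fun m => f (i - m))))) y (f 3) (f 0) b₀ := by
        refine ⟨⟨?_, hx1.symm, ?_, ?_⟩, ?_⟩
        · refine (((hp.rev (b := i) (m := i - 2) (by omega) (by omega)).cons hui ?_).cons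
            hu ?_).cons h.tri.ab2 ?_
          · intro m h0 hm e
            have := hum _ (by omega) (by omega) e
            omega
          · rintro (_ | m) h0 hm
            · omega
            · exact hy _ (by omega)
          · rintro (_ | _ | m) h0 hm
            · omega
            · exact not_adj_symm ux
            · exact hx2 _ (by omega) (by omega)
        · rw [hend]; exact hp.adj_succ (by omega)
        · rintro (_ | _ | _ | m) h0 hm
          · omega
          · exact not_adj_symm (hy 1 (by omega))
          · exact not_adj_symm u1
          · exact hp.not_adj (by omega) (by omega) (by omega) (by omega)
        · rw [hend, seqCons_zero]
          exact
          { ca0 := hx1.symm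
            ca1 := hp.adj_succ (by omega)
            ca2 := (hp.adj_succ (by omega)).symm
            ab0 := h.tri.ab2
            ab1 := hp.adj_succ (by omega)
            ab2 := h.tri.ab0
            aa01 := hx2 2 (by omega) (by omega)
            aa02 := not_adj_symm h.tri.aa02
            aa12 := hp.not_adj (by omega) (by omega) (by omega) (by omega)
            ab01 := hx2 3 (by omega) (by omega)
            ab02 := h.tri.ab20
            ab10 := not_adj_symm (hy 2 (by omega))
            ab12 := not_adj_symm (hb 2 (by omega) (by omega))
            ab20 := h.tri.ab02
            ab21 := hp.not_adj (by omega) (by omega) (by omega) (by omega)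
            bb01 := hy 3 (by omega)
            bb02 := not_adj_symm h.tri.bb02
            bb12 := not_adj_symm (hb 3 (by omega) (by omega))
            cb0 := not_adj_symm (hy 1 (by omega))
            cb1 := hp.not_adj (by omega) (by omega) (by omega) (by omega)
            cb2 := not_adj_symm (hb 1 (by omega) (by omega)) }
      refine S.win_of_free hG hM ?_ (by omega)
      exact not_adj_seqCons h.tri.aa02 <| not_adj_seqCons h.tri.ab02 <|
        not_adj_seqCons (not_adj_symm u0) fun m hm =>
          hp.not_adj (by omega) (by omega) (by omega) (by omega)
    · exact h.win_mid (w := u) (s := y) (e := x) (i := i) (j := j) (by omega) hj hui huj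
        (fun m h1 => hum m (by omega)) hu h.tri.ab2 (not_adj_symm ux)
        (fun m _ _ => hy m (by omega)) (fun m _ _ => hx2 m (by omega) (by omega)) (by omega)
  · have hu2 : ∀ m ≤ n, ¬ G.Adj u (f m) := by
      rintro (_ | _ | m) hm e
      · exact u0 e
      · exact u1 e
      · exact hw ⟨_, hm, by omega, e⟩
    have hP : IndPath G (n - 1 + 1) (seqCons c (fun m => f (n - m))) :=
      (hp.rev (b := n) (m := n - 1) (by omega) (by omega)).cons h.ring.cn
        fun m h0 hm => h.ring.mid _ (by omega) (by omega)
    have hend : seqCons c (fun m => f (n - m)) (n - 1 + 1) = f 1 := by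
      simp [Nat.sub_sub_self (show 1 ≤ n by omega)]
    refine win_apple (z := x) (s := y) (e := u) hP (by omega) ?_ h.tri.ca2.symm ?_ ?_
      h.tri.ab2.symm ?_ hu.symm ux ?_ (by omega)
    · rw [hend]; exact hc _ (by omega)
    · rw [hend]; exact hx1
    · rintro (_ | m) h0 hm
      · omega
      · exact hx2 _ (by omega) (by omega)
    · exact not_adj_seqCons (not_adj_symm h.tri.cb2) fun m hm => hy _ (by omega)
    · exact not_adj_seqCons uc fun m hm => hu2 _ (by omega)

/-- The leg `x` is adjacent to `f 1` and to no other vertex of the path. -/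
theorem win_of_square (h : Setup G c n f b₀ b₁ x y) (hG : Subcubic G) (hM : NoPendant G)
    (hc : ∀ m ≤ n, c ≠ f m) (hx1 : G.Adj x (f 1)) (hx : ∀ m ≤ n, G.Adj x (f m) → m = 1)
    {k : ℕ} (h5 : 5 * k ≤ n + 15) (h7 : 7 * k ≤ n + 22) : Win G k := by
  have hp := h.ring.path
  have h2 := h.two_le
  have hbn := h.b_ne_of_square hx1
  have hyn := h.y_ne_of_square hx
  have S := h.swap_square hx1 hx
  have hS1 : G.Adj (f 0) (seqCons x (fun m => f (m + 1)) 1) := hp.adj_succ (by omega)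
  have hS : ∀ m ≤ n, G.Adj (f 0) (seqCons x (fun m => f (m + 1)) m) → m = 1 := by
    rintro (_ | m) hm e
    · exact absurd e h.tri.aa02
    · have := (hp.adj_iff (by omega) hm).1 e
      omega
  have hSf : ∀ m, 1 ≤ m → seqCons x (fun m => f (m + 1)) m = f m := by
    rintro (_ | m) hm
    · omega
    · rfl
  have hSf0 : ¬ G.Adj b₀ (seqCons x (fun m => f (m + 1)) 0) := not_adj_symm h.tri.ab20
  by_cases hyw : ∃ m ≤ n, G.Adj y (f m)
  · obtain ⟨i, j, hi, hij, hj, hyi, hyj, hy⟩ := h.attach_y hG hyw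
    by_cases hbw : ∃ m ≤ n, G.Adj b₀ (seqCons x (fun m => f (m + 1)) m)
    · obtain ⟨i', j', hi', hij', hj', hbi, hbj, hb⟩ := S.attach_y hG hbw
      -- By the symmetry exchanging `x` and `f 0`, the leaf attached first along the path may play
      -- the role of `y`. A tie is impossible: the inner vertex `f i` has room for only one
      -- neighbour off the path.
      rcases lt_trichotomy i i' with hlt | rfl | hlt
      · refine h.win_of_square_adj hG hM hx1 hx hi hij hj hyi hyj hy (fun m h1 hm e => ?_) h5
        rw [← hSf m h1] at e
        have := hb m (by omega) e
        omega
      · rw [hSf i hi] at hbi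
        have := h.full hG hi (by omega) hyi.symm hyn hbi.symm hbn
        exact absurd h.tri.ab0 (this ▸ h.tri.ab02)
      · refine S.win_of_square_adj hG hM hS1 hS hi' hij' hj' hbi hbj hb (fun m h1 hm e => ?_) h5
        rw [hSf m h1] at e
        have := hy m (by omega) e
        omega
    · refine h.win_of_square_adj hG hM hx1 hx hi hij hj hyi hyj hy (fun m h1 hm e => ?_) h5
      exact hbw ⟨m, by omega, by rwa [hSf m h1]⟩
  · push Not at hyw
    by_cases hbw : ∃ m ≤ n, G.Adj b₀ (seqCons x (fun m => f (m + 1)) m)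
    · obtain ⟨i', j', hi', hij', hj', hbi, hbj, hb⟩ := S.attach_y hG hbw
      refine S.win_of_square_adj hG hM hS1 hS hi' hij' hj' hbi hbj hb (fun m h1 hm e => ?_) h5
      rw [hSf m h1] at e
      exact hyw m (by omega) e
    · refine h.win_of_square_free hG hM hc hx1 hx hyw (fun m h1 hm e => ?_) h7
      exact hbw ⟨m, hm, by rwa [hSf m h1]⟩

/-! ### Combining the cases -/

/-- The leg `x` is adjacent to `f 1` or `f 2` and to no other vertex of the path. -/
theorem win_of_near (h : Setup G c n f b₀ b₁ x y) (hG : Subcubic G) (hM : NoPendant G)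
    (hc : ∀ m ≤ n, c ≠ f m) {i k : ℕ} (hi : 1 ≤ i) (hi2 : i ≤ 2) (hin : i < n)
    (hxi : G.Adj x (f i)) (hx : ∀ m ≤ n, G.Adj x (f m) → m = i) (hk : 8 * k ≤ n + 9) :
    Win G k := by
  rcases Nat.lt_or_ge i 2 with h1 | h1
  · obtain rfl : i = 1 := by omega
    exact h.win_of_square hG hM hc hxi hx (by omega) (by omega)
  -- For `i = 2` the cycle `c, x, f 2, …, f n` is only one shorter. It omits `f 1`, the only path
  -- neighbour of `f 0`, so `f 0` is a free third leg.
  · refine (h.rev.restrict (i := n - i) (by omega) ?_ ?_).win_of_free hG hM ?_ (by omega)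
    · rwa [Nat.sub_sub_self hin.le]
    · intro m hm e
      have := hx _ (by omega) e
      omega
    · simp only [Nat.sub_self]
      exact not_adj_seqCons h.tri.aa02 fun m hm =>
        h.ring.path.not_adj (by omega) (by omega) (by omega) (by omega)

/-- If `x` has two path neighbours besides `c`, its degree forces `y` to be one of them, and
reversal decides which. With one path neighbour, either it is within two steps of an end of the
path, or one of the two cycles cut off by `x` is a long enough apple. -/
theorem win (h : Setup G c n f b₀ b₁ x y) (hG : Subcubic G) (hM : NoPendant G)
    (hc : ∀ m ≤ n, c ≠ f m) {k : ℕ} (hk : 8 * k ≤ n + 9) : Win G k := by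
  have h2 := h.two_le
  by_cases hw : ∃ m ≤ n, G.Adj x (f m)
  · obtain ⟨i, j, -, hij, hj, hxi, hxj, hx⟩ := h.attach hG h.tri.ca2.symm 0
      (fun m _ => hc m) (by simpa using hw)
    have hi0 : i ≠ 0 := by rintro rfl; exact h.tri.aa02 hxi.symm
    have hjn : j ≠ n := by rintro rfl; exact h.tri.aa12 hxj.symm
    rcases hij.lt_or_eq with hlt | rfl
    · have hcy : c ≠ y := by rintro rfl; exact h.tri.ab02 h.ring.c0.symm
      rcases hG h.tri.ca2.symm hxi hxj (hc _ (by omega)) (hc _ hj)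
        (h.ne (by omega) hj (by omega)) h.tri.ab2 with e | e | e
      · exact absurd e.symm hcy
      · refine h.win_of_two hG hM ?_ hlt (by omega) hxi hxj (fun m => hx m (by omega)) (by omega)
        by_contra h1
        obtain rfl : i = 1 := by omega
        exact h.tri.ab02 (e ▸ h.ring.path.adj_succ (by omega))
      · refine h.rev.win_of_two hG hM (i := n - j) (j := n - i) ?_ (by omega) (by omega) ?_ ?_ ?_
          (by omega)
        · by_contra h1
          obtain rfl : j = n - 1 := by omega
          exact h.tri.ab12 (e ▸ (h.ring.path.adj_iff (by omega) (by omega)).2 (by omega))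
        · rwa [Nat.sub_sub_self hj]
        · rwa [Nat.sub_sub_self (by omega)]
        · intro m hm e
          have := hx _ (by omega) (by omega) e
          omega
    · have hx' : ∀ m ≤ n, G.Adj x (f m) → m = i := fun m hm e => by
        have := hx m (by omega) hm e
        omega
      by_cases h3 : i ≤ 2
      · exact h.win_of_near hG hM hc (by omega) h3 (by omega) hxi hx' hk
      by_cases h4 : n ≤ i + 2
      · refine h.rev.win_of_near hG hM (fun m _ => hc (n - m) (by omega)) (i := n - i) (by omega)
          (by omega) (by omega) ?_ ?_ hk
        · rwa [Nat.sub_sub_self (by omega)]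
        · intro m hm e
          have := hx' _ (by omega) e
          omega
      by_cases h5 : k ≤ i + 3
      · refine h.win_before (by omega) (by omega) hxi (fun m hm e => ?_) (fun e => ?_) h5
        all_goals
          have := hx' _ (by omega) e
          omega
      · refine h.win_after (by omega) (by omega) hxi (fun m h1 hm e => ?_) (fun e => ?_) (by omega)
        all_goals
          have := hx' _ (by omega) e
          omega
  · push Not at hw
    exact h.win_of_free hG hM hw (by omega)

end Setup

end

/-! ### From the graph hypotheses to a centred cycle -/

theorem subcubic_of_degree_le {V : Type*} [Fintype V] {G : SimpleGraph V} [DecidableRel G.Adj]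
    (hdeg : ∀ v, G.degree v ≤ 3) : Subcubic G := by
  classical
  intro v a b c d ha hb hc hab hac hbc hd
  by_contra hcon
  push Not at hcon
  have hsub : ({a, b, c, d} : Finset V) ⊆ G.neighborFinset v := by
    intro w hw
    simp only [Finset.mem_insert, Finset.mem_singleton] at hw
    rw [SimpleGraph.mem_neighborFinset]
    rcases hw with rfl | rfl | rfl | rfl <;> assumption
  have hcard : ({a, b, c, d} : Finset V).card = 4 := by
    rw [Finset.card_insert_of_notMem (by simp [hab, hac, hcon.1.symm]),
      Finset.card_insert_of_notMem (by simp [hbc, hcon.2.1.symm]),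
      Finset.card_insert_of_notMem (by simp [hcon.2.2.symm]), Finset.card_singleton]
  have h1 := Finset.card_le_card hsub
  rw [hcard, SimpleGraph.card_neighborFinset_eq_degree] at h1
  have := hdeg v
  omega

/-- A single vertex `a` is a clique, so `G - a` is preconnected; the first step of a walk in it from
`b` to a third vertex gives the second neighbour of `b`. -/
theorem noPendant_of_not_isSeparatingClique {V : Type*} {G : SimpleGraph V}
    (hsep : ∀ K : Set V, ¬ IsSeparatingClique G K) (hV : ∀ a b : V, ∃ v, v ≠ a ∧ v ≠ b) :
    NoPendant G := by
  intro a b hab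
  obtain ⟨v, hva, hvb⟩ := hV a b
  have hpre : (G.induce ({a} : Set V)ᶜ).Preconnected := by
    by_contra hn
    exact hsep {a} ⟨SimpleGraph.isClique_singleton _, hn⟩
  obtain ⟨w⟩ := hpre ⟨b, by simpa using hab.ne'⟩ ⟨v, by simpa using hva⟩
  cases w with
  | nil => exact absurd rfl hvb
  | @cons _ u _ h _ => exact ⟨u.1, fun e => u.2 (by simp [e]), h⟩

theorem tri_of_embedding {V : Type*} {G : SimpleGraph V} (H : tripod222 ↪g G) :
    Tri G (H 0) (H 1) (H 4) (H 2) (H 5) (H 3) (H 6) := by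
  constructor <;> rw [H.map_adj_iff] <;> simp [tripod222]

/-- Two neighbours of the centre of a tripod in a subcubic graph are legs. -/
theorem Tri.exists_of_adj {V : Type*} {G : SimpleGraph V} {c a₀ b₀ a₁ b₁ a₂ b₂ : V}
    (h : Tri G c a₀ b₀ a₁ b₁ a₂ b₂) (hG : Subcubic G) {u v : V} (hu : G.Adj c u)
    (hv : G.Adj c v) (huv : u ≠ v) : ∃ b b' x y, Tri G c u b v b' x y := by
  rcases hG h.ca0 h.ca1 h.ca2 h.ne01 h.ne02 h.ne12 hu with rfl | rfl | rfl <;>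
    rcases hG h.ca0 h.ca1 h.ca2 h.ne01 h.ne02 h.ne12 hv with rfl | rfl | rfl
  · exact absurd rfl huv
  · exact ⟨_, _, _, _, h⟩
  · exact ⟨_, _, _, _, h.swap01.swap02.swap01⟩
  · exact ⟨_, _, _, _, h.swap01⟩
  · exact absurd rfl huv
  · exact ⟨_, _, _, _, h.swap02.swap01⟩
  · exact ⟨_, _, _, _, h.swap01.swap02⟩
  · exact ⟨_, _, _, _, h.swap02⟩
  · exact absurd rfl huv

theorem cycleGraph_adj_add_natCast {n i j : ℕ} (k : Fin (n + 2)) (hij : i < j) (hj : j < n + 2) :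
    (SimpleGraph.cycleGraph (n + 2)).Adj (k + Fin.ofNat (n + 2) i) (k + Fin.ofNat (n + 2) j) ↔
      j = i + 1 ∨ (i = 0 ∧ j = n + 1) := by
  have h1 : k + Fin.ofNat (n + 2) i - (k + Fin.ofNat (n + 2) j) = Fin.ofNat (n + 2) i - Fin.ofNat (n + 2) j :=
    add_sub_add_left_eq_sub _ _ _
  have h2 : k + Fin.ofNat (n + 2) j - (k + Fin.ofNat (n + 2) i) = Fin.ofNat (n + 2) j - Fin.ofNat (n + 2) i :=
    add_sub_add_left_eq_sub _ _ _
  rw [SimpleGraph.cycleGraph_adj', h1, h2, ← SimpleGraph.cycleGraph_adj']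
  rcases Nat.eq_zero_or_pos n with rfl | hn
  · obtain rfl : i = 0 := by omega
    obtain rfl : j = 1 := by omega
    simp [SimpleGraph.cycleGraph_adj]
  · have e1 : (Fin.ofNat (n + 2) i : ℕ) = i := by
      rw [Fin.val_ofNat, Nat.mod_eq_of_lt (by omega)]
    have e2 : (Fin.ofNat (n + 2) j : ℕ) = j := by
      rw [Fin.val_ofNat, Nat.mod_eq_of_lt hj]
    rw [cycleGraph_adj_of_lt (by omega) (by omega), e1, e2]
    omega

theorem mainTheorem3 {V : Type*} [Fintype V] (G : SimpleGraph V) [DecidableRel G.Adj]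
    (hdeg : ∀ v, G.degree v ≤ 3)
    (hconn : G.Connected)
    (hsep : ∀ K : Set V, ¬ IsSeparatingClique G K)
    (p : ℕ) (hp : 3 ≤ p)
    (C : SimpleGraph.cycleGraph p ↪g G)
    (H : tripod222 ↪g G) (hC : H 0 ∈ Set.range C) :
    ∃ t : ℕ, (p : ℝ) / 8 ≤ t ∧
      ((5 ≤ t ∧ Nonempty (extendedCycle t ↪g G)) ∨
        (4 ≤ t ∧ Nonempty (longStemApple t ↪g G))) := by
  obtain ⟨n, rfl⟩ : ∃ n, p = n + 2 := ⟨p - 2, by omega⟩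
  obtain ⟨k, hk⟩ := hC
  have hG := subcubic_of_degree_le hdeg
  have hM : NoPendant G := by
    refine noPendant_of_not_isSeparatingClique hsep fun a b => ?_
    have h01 : H 0 ≠ H 1 := H.injective.ne (by decide)
    have h02 : H 0 ≠ H 2 := H.injective.ne (by decide)
    have h12 : H 1 ≠ H 2 := H.injective.ne (by decide)
    by_contra hn
    push Not at hn
    rcases eq_or_ne (H 0) a with h | h
    · exact h12 ((hn _ fun e => h01 (h.trans e.symm)).trans
        (hn _ fun e => h02 (h.trans e.symm)).symm)
    · rcases eq_or_ne (H 1) a with h' | h'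
      · exact h02 ((hn _ h).trans (hn _ fun e => h12 (h'.trans e.symm)).symm)
      · exact h01 ((hn _ h).trans (hn _ h').symm)
  -- The cycle is rotated so that it starts at the centre; addition in `Fin (n + 2)` is modulo the
  -- length.
  let g : ℕ → V := fun i => C (k + Fin.ofNat (n + 2) i)
  have g0 : g 0 = H 0 := by simpa [g] using hk
  have hadj : ∀ i j, i < j → j < n + 2 →
      (G.Adj (g i) (g j) ↔ j = i + 1 ∨ (i = 0 ∧ j = n + 1)) := fun i j hij hj =>
    C.map_adj_iff.trans (cycleGraph_adj_add_natCast k hij hj)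
  have hne : ∀ i j, i < j → j < n + 2 → g i ≠ g j := by
    intro i j hij hj h
    have h1 := add_left_cancel (C.injective h)
    rw [Fin.ext_iff, Fin.val_ofNat, Fin.val_ofNat, Nat.mod_eq_of_lt (by omega),
      Nat.mod_eq_of_lt hj] at h1
    omega
  have hring : RingAt G (H 0) n (fun i => g (i + 1)) := by
    rw [← g0]
    refine ⟨fun i j hij hj => ?_, ?_, ?_, fun i h0 hn => ?_⟩
    · rw [hadj _ _ (by omega) (by omega)]
      omega
    · exact (hadj 0 1 (by omega) (by omega)).2 (by omega)
    · exact (hadj 0 (n + 1) (by omega) (by omega)).2 (by omega)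
    · rw [hadj _ _ (by omega) (by omega)]
      omega
  obtain ⟨b, b', x, y, hT⟩ := (tri_of_embedding H).exists_of_adj hG hring.c0 hring.cn
    (hne _ _ (by omega) (by omega))
  -- The floor of `(n + 9) / 8` is the ceiling of `p / 8`, since `p = n + 2`.
  obtain ⟨t, ht, hw⟩ := Setup.win ⟨hring, hT⟩ hG hM
    (fun m hm => g0 ▸ hne 0 (m + 1) (by omega) (by omega)) (k := (n + 9) / 8) (by omega)
  refine ⟨t, ?_, hw⟩
  rw [div_le_iff₀ (by norm_num)]
  have : n + 2 ≤ t * 8 := by omega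
  exact_mod_cast this
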